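/- **Setting.** Let $\mathcal X\subset\mathbb R^n$ be compact with convex hull $\mathcal K$, $A\in\mathbb R^{n\times n}$, $b\in\mathbb R^n$, and consider $\dot x=Ax+b\,(f(x)+g(x)u)$ with states $x\in\mathcal X$ and unknown $f,g:\mathbb R^n\to\mathbb R$. *Prior, data, posterior.* A priori $f$ and $g$ are independent centred Gaussian processes with kernels $k_f,k_g$, where $k_f(x,x)=s_f^2$, $s_f\ge0$. A fixed data set $\mathbb D=\{(x^{(i)},u^{(i)},y^{(i)})\}_{i=1}^N$ is given, with $y^{(i)}=f(x^{(i)})+g(x^{(i)})u^{(i)}+\omega^{(i)}$ and independent noise $\omega^{(i)}\sim\mathcal N(0,\sigma_{\rm on}^2)$, $\sigma_{\rm on}>0$. The posterior probability is the prior conditioned on $\mathbb D$ by Bayes' rule. With $K_{ij}=k_f(x^{(i)},x^{(j)})+u^{(i)}k_g(x^{(i)},x^{(j)})u^{(j)}$, $M=(K+\sigma_{\rm on}^2I)^{-1}$, $U_{\mathbb D}=\operatorname{diag}(u^{(1)},\dots,u^{(N)})$, $\mathbf k_{f,i}(x)=k_f(x,x^{(i)})$, $\mathbf k_{g,i}(x)=k_g(x,x^{(i)})$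 put $$\mu_f=\mathbf k_f^TMy,\quad \mu_g=\mathbf k_g^TU_{\mathbb D}My,\quad \sigma_f^2(x)=k_f(x,x)-\mathbf k_f^TM\mathbf k_f,\quad \sigma_g^2(x)=k_g(x,x)-\mathbf k_g^TU_{\mathbb D}MU_{\mathbb D}\mathbf k_g .$$ Let $\mu_f,\mu_g,\sigma_f,\sigma_g$ be Lipschitz on $\mathcal K$ with constants $L_{\mu_f},L_{\mu_g},L_{\sigma_f},L_{\sigma_g}$. Fix $L_f,L_g\ge 0$, $\delta\in(0,1)$, $\underline\sigma_f,\underline\sigma_g>0$, and put $\tilde\sigma_f=\max\{\sigma_f,\underline\sigma_f\}$, $\tilde\sigma_g=\max\{\sigma_g,\underline\sigma_g\}$ and, for $h\in\{f,g\}$, $$\tau_h=\frac{\underline\sigma_h}{L_h+L_{\mu_h}+L_{\sigma_h}},\qquad \beta_h=8\log\Big(\frac2\delta\prod_{j=1}^n\Big(\frac{\sqrt n}{2\tau_h}\big(\max_{x\in\mathcal X}x_j-\min_{x\in\mathcal X}x_j\big)+1\Big)\Big)$$ (with $1/\tau_h=0$ if $L_h+L_{\mu_h}+L_{\sigma_h}=0$).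 *Barrier function.* Let $\psi$ be $C^2$ on an open neighbourhood of $\mathcal X$, $\mathcal C=\{x\in\mathcal X:\psi(x)\ge0\}$, and suppose that all points with $\psi\ge0$ in some open neighbourhood of $\mathcal C$ belong to $\mathcal X$ (e.g. $\mathcal C\subset\operatorname{int}\mathcal X$). Let $\alpha:\mathbb R\to\mathbb R$ be a Lipschitz extended class $\mathcal K_\infty$ function such that $\psi$ is a control barrier function for the nominal linear system ($f=0$, $g=1$): for each $x\in\mathcal C$ some $u$ in the input set $\mathcal U\subseteq\mathbb R$ satisfies $\nabla\psi(x)^TAx+\alpha(\psi(x))+\nabla\psi(x)^Tb\,u\ge0$. Let $\pi_{\rm nom}:\mathcal X\to\mathbb R$ be Lipschitz. *Gradient condition.* For some $\zeta_1>0$ and $\bar f\in\mathbb R$ with $\zeta_2:=\zeta_1(\bar f+2\sqrt{\beta_f}s_f)>0$: $\alpha(\psi(x))\ge-\nabla\psi(x)^TAx+\zeta_2$ for all $x\in\mathcal X$ with $|\nabla\psi(x)^Tb|\le\zeta_1$. *Excitation condition.* $\mu_g(x)/(\sqrt{\beta_g}\,\tilde\sigma_g(x))>1$ for all $x\in\mathcal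 X$. **Claim.** Consider the filter $\pi(x)=\arg\min_{u\in\mathbb R}|u-\pi_{\rm nom}(x)|$ subject to $\xi_s(x)u\le\xi_3(x)$, where $$\xi_1=|\nabla\psi^Tb|\sqrt{\beta_g}\tilde\sigma_g,\quad \xi_2=-\nabla\psi^Tb\,\mu_g,\quad \xi_3=\alpha(\psi)+\nabla\psi^TAx+\nabla\psi^Tb\,\mu_f-|\nabla\psi^Tb|\sqrt{\beta_f}\tilde\sigma_f,\quad \xi_s=\operatorname{sgn}(\xi_2\xi_3)\xi_1+\xi_2 .$$ 1. The filter is feasible at every $x\in\mathcal X$ and has exactly one minimizer $\pi(x)$, and $\pi$ is (globally) Lipschitz on $\mathcal X$. 2. Let $\underline g>0$. There is an event of posterior probability at least $1-\delta$ on which the following holds: if $f$ and $g$ are Lipschitz on $\mathcal K$ with constants $L_f$ and $L_g$, and $f\le\bar f$, $g\ge\underline g$ on $\mathcal X$, then from every $x_0\in\mathcal C$ the closed loop $\dot x=Ax+b(f(x)+g(x)\pi(x))$ has a unique solution in $\mathcal X$ for all $t\ge0$, and it stays in $\mathcal C$ for all $t\ge0$. -/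

import Mathlib

open MeasureTheory ProbabilityTheory Filter Topology
open scoped NNReal ENNReal Gradient RealInnerProductSpace

noncomputable section

namespace SafeGP

/-- The state space `ℝⁿ` with the Euclidean norm. -/
abbrev State (n : ℕ) : Type := EuclideanSpace ℝ (Fin n)

/-! ### Control barrier functions -/

/-- Extended class `K_∞` functions. -/
structure IsExtendedClassK (α : ℝ → ℝ) : Prop where
  continuous : Continuous α
  strictMono : StrictMono α
  map_zero : α 0 = 0
  tendsto_atTop : Tendsto α atTop atTop
  tendsto_atBot : Tendsto α atBot atBot

/-- Right-hand side of `ẋ = A x + b (f(x) + g(x) u)`. -/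
def dynamics {n : ℕ} (A : Matrix (Fin n) (Fin n) ℝ) (b : State n) (f g : State n → ℝ)
    (x : State n) (u : ℝ) : State n :=
  Matrix.toEuclideanLin A x + (f x + g x * u) • b

/-- `ψ`, together with `α`, is a control barrier function for `ẋ = A x + b (f(x) + g(x) u)` with
inputs `u ∈ U` on the set `C`: at every `x ∈ C` some `u ∈ U` satisfies `c(x) + d(x) u ≥ 0`. -/
def IsCBF {n : ℕ} (A : Matrix (Fin n) (Fin n) ℝ) (b : State n) (f g : State n → ℝ)
    (U : Set ℝ) (ψ : State n → ℝ) (α : ℝ → ℝ) (C : Set (State n)) : Prop :=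
  IsExtendedClassK α ∧
    ∀ x ∈ C, ∃ u ∈ U,
      0 ≤ (⟪∇ ψ x, Matrix.toEuclideanLin A x + f x • b⟫ + α (ψ x)) + (⟪∇ ψ x, b⟫ * g x) * u

/-! ### Gaussian process priors, data, Bayesian posterior -/

/-- `F` is a centred Gaussian process with covariance kernel `k` under `P`. -/
structure IsCenteredGP {n : ℕ} {Ω : Type*} [MeasurableSpace Ω] (F : State n → Ω → ℝ)
    (k : State n → State n → ℝ) (P : Measure Ω) : Prop where
  isGaussianProcess : IsGaussianProcess F P
  mean_eq_zero : ∀ x, ∫ ω, F x ω ∂P = 0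
  covariance_eq : ∀ x x', cov[F x, F x'; P] = k x x'

/-- A data set of `N` triples (state, input, measured output). -/
structure Dataset (n N : ℕ) where
  x : Fin N → State n
  u : Fin N → ℝ
  y : Fin N → ℝ

/-- Likelihood of the outputs `y⁽ⁱ⁾ = f(x⁽ⁱ⁾) + g(x⁽ⁱ⁾) u⁽ⁱ⁾ + ω⁽ⁱ⁾`, with independent noise
`ω⁽ⁱ⁾ ∼ 𝒩(0, σ²)`, when the unknown functions are `f` and `g`. -/
def likelihood {n N : ℕ} (D : Dataset n N) (σ : ℝ≥0) (f g : State n → ℝ) : ℝ≥0∞ :=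
  ∏ i, gaussianPDF (f (D.x i) + g (D.x i) * D.u i) (σ ^ 2) (D.y i)

/-- Bayesian posterior: the prior measure `P`, under which `F` and `G` are the random functions
`f` and `g`, conditioned on the data set (the prior reweighted by the likelihood of the data and
normalised). -/
def posterior {n N : ℕ} {Ω : Type*} [MeasurableSpace Ω] (P : Measure Ω)
    (F G : State n → Ω → ℝ) (D : Dataset n N) (σ : ℝ≥0) : Measure Ω :=
  (∫⁻ ω, likelihood D σ (fun x => F x ω) (fun x => G x ω) ∂P)⁻¹ •
    P.withDensity (fun ω => likelihood D σ (fun x => F x ω) (fun x => G x ω))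

/-! ### The objects of the problem -/

/-- All the parameters of the problem; no property of them is assumed here. -/
structure Setup (n N : ℕ) where
  /-- system matrix -/
  A : Matrix (Fin n) (Fin n) ℝ
  /-- input vector -/
  b : State n
  /-- domain of the states -/
  X : Set (State n)
  /-- set of inputs -/
  U : Set ℝ
  /-- barrier function -/
  ψ : State n → ℝ
  /-- extended class `K_∞` function that belongs to `ψ` -/
  α : ℝ → ℝ
  /-- nominal control law -/
  πnom : State n → ℝ
  /-- prior covariance kernel of `f` -/
  kf : State n → State n → ℝ
  /-- prior covariance kernel of `g` -/
  kg : State n → State n → ℝ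
  /-- standard deviation of the measurement noise -/
  σon : ℝ≥0
  /-- the data set -/
  D : Dataset n N
  /-- the constant `s_f`, with `s_f² = k_f(x, x)` -/
  sf : ℝ
  /-- upper bound of `f` -/
  fbar : ℝ
  /-- lower bound of `g` -/
  glow : ℝ
  /-- Lipschitz constant of `f` -/
  Lf : ℝ≥0
  /-- Lipschitz constant of `g` -/
  Lg : ℝ≥0
  /-- Lipschitz constant of the posterior mean of `f` -/
  Lμf : ℝ≥0
  /-- Lipschitz constant of the posterior mean of `g` -/
  Lμg : ℝ≥0
  /-- Lipschitz constant of the posterior standard deviation of `f` -/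
  Lσf : ℝ≥0
  /-- Lipschitz constant of the posterior standard deviation of `g` -/
  Lσg : ℝ≥0
  /-- admissible probability of failure -/
  δ : ℝ
  /-- floor of the standard deviation of `f` -/
  σlowf : ℝ
  /-- floor of the standard deviation of `g` -/
  σlowg : ℝ
  /-- threshold in the gradient condition -/
  ζ₁ : ℝ

namespace Setup

variable {n N : ℕ} (S : Setup n N)

/-- The safe set `C`. -/
def safeSet : Set (State n) := {x ∈ S.X | 0 ≤ S.ψ x}

/-! Gaussian process regression with the composite kernel -/

/-- Gram matrix of the composite kernel `k_f(x, x') + u k_g(x, x') u'`. -/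
def gram : Matrix (Fin N) (Fin N) ℝ :=
  Matrix.of fun i j =>
    S.kf (S.D.x i) (S.D.x j) + S.D.u i * S.kg (S.D.x i) (S.D.x j) * S.D.u j

/-- `(K_h + σ_on² I)⁻¹`. -/
def invGram : Matrix (Fin N) (Fin N) ℝ := (S.gram + ((S.σon : ℝ) ^ 2) • 1)⁻¹

/-- The vector `k_f(x)`. -/
def kvecf (x : State n) : Fin N → ℝ := fun i => S.kf x (S.D.x i)

/-- The vector `U k_g(x)`, with `U = diag(u⁽¹⁾, …, u⁽ᴺ⁾)`. -/
def kvecg (x : State n) : Fin N → ℝ :=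
  Matrix.mulVec (Matrix.diagonal S.D.u) (fun i => S.kg x (S.D.x i))

/-- Posterior mean of `f`. -/
def μf (x : State n) : ℝ := S.kvecf x ⬝ᵥ Matrix.mulVec S.invGram S.D.y

/-- Posterior mean of `g`. -/
def μg (x : State n) : ℝ := S.kvecg x ⬝ᵥ Matrix.mulVec S.invGram S.D.y

/-- Posterior standard deviation of `f`. -/
def σf (x : State n) : ℝ :=
  √(S.kf x x - S.kvecf x ⬝ᵥ Matrix.mulVec S.invGram (S.kvecf x))

/-- Posterior standard deviation of `g`. -/
def σg (x : State n) : ℝ :=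
  √(S.kg x x - S.kvecg x ⬝ᵥ Matrix.mulVec S.invGram (S.kvecg x))

/-- `σ̃_f = max {σ_f, floor}`. -/
def σtf (x : State n) : ℝ := max (S.σf x) S.σlowf

/-- `σ̃_g = max {σ_g, floor}`. -/
def σtg (x : State n) : ℝ := max (S.σg x) S.σlowg

/-- `max_{x ∈ X} x_j - min_{x ∈ X} x_j`. -/
def width (j : Fin n) : ℝ :=
  sSup ((fun x : State n => x j) '' S.X) - sInf ((fun x : State n => x j) '' S.X)

/-- Resolution of the covering for `f`. -/
def τf : ℝ := S.σlowf / (S.Lf + S.Lμf + S.Lσf)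

/-- Resolution of the covering for `g`. -/
def τg : ℝ := S.σlowg / (S.Lg + S.Lμg + S.Lσg)

/-- The scaling factor `β_f`. If the three Lipschitz constants vanish, every factor of the product
is `1`, which is also the value for `τ_f → ∞`. -/
def βf : ℝ := 8 * Real.log (2 / S.δ * ∏ j : Fin n, (√n / (2 * S.τf) * S.width j + 1))

/-- The scaling factor `β_g`. -/
def βg : ℝ := 8 * Real.log (2 / S.δ * ∏ j : Fin n, (√n / (2 * S.τg) * S.width j + 1))

/-- `ζ₂ = ζ₁ (f̄ + 2 √β_f s_f)`. -/
def ζ₂ : ℝ := S.ζ₁ * (S.fbar + 2 * √S.βf * S.sf)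

/-! The safety filter -/

def ξ₁ (x : State n) : ℝ := |⟪∇ S.ψ x, S.b⟫| * √S.βg * S.σtg x

def ξ₂ (x : State n) : ℝ := -⟪∇ S.ψ x, S.b⟫ * S.μg x

def ξ₃ (x : State n) : ℝ :=
  S.α (S.ψ x) + ⟪∇ S.ψ x, Matrix.toEuclideanLin S.A x⟫ + ⟪∇ S.ψ x, S.b⟫ * S.μf x
    - |⟪∇ S.ψ x, S.b⟫| * √S.βf * S.σtf x

def ξs (x : State n) : ℝ := Real.sign (S.ξ₂ x * S.ξ₃ x) * S.ξ₁ x + S.ξ₂ x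

/-- The inputs that satisfy the constraint of the filter at `x`. -/
def feasibleInputs (x : State n) : Set ℝ := {u | S.ξs x * u ≤ S.ξ₃ x}

/-- `u` solves the quadratic program
`min |u - π_nom(x)|` subject to `ξ_s(x) u ≤ ξ₃(x)`. -/
def IsFilterInput (x : State n) (u : ℝ) : Prop :=
  u ∈ S.feasibleInputs x ∧ ∀ v ∈ S.feasibleInputs x, |u - S.πnom x| ≤ |v - S.πnom x|

/-! Unknown functions and closed loop -/

/-- The assumptions on the unknown functions: `f` and `g` have the Lipschitz constants `L_f`,
`L_g` (on the convex hull of `X`), `f ≤ f̄` and `g ≥ g̲` on `X`. -/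
structure Admissible (f g : State n → ℝ) : Prop where
  lipschitz_f : LipschitzOnWith S.Lf f (convexHull ℝ S.X)
  lipschitz_g : LipschitzOnWith S.Lg g (convexHull ℝ S.X)
  le_fbar : ∀ x ∈ S.X, f x ≤ S.fbar
  glow_le : ∀ x ∈ S.X, S.glow ≤ g x

/-- `x` is, on the time interval `I`, a solution in `X` of the closed loop
`ẋ = A x + b (f(x) + g(x) π(x))`. -/
def IsClosedLoopSolution (f g π : State n → ℝ) (I : Set ℝ) (x : ℝ → State n) : Prop :=
  ∀ t ∈ I, x t ∈ S.X ∧ HasDerivWithinAt x (dynamics S.A S.b f g (x t) (π (x t))) I t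

/-- The closed loop under `π` is safe: from every initial state in `C` there is a solution for all
`t ≥ 0`, it stays in `C`, and every other solution from that state coincides with it as long as
it exists (so that no solution leaves `C`). -/
def IsSafe (f g π : State n → ℝ) : Prop :=
  ∀ x₀ ∈ S.safeSet, ∃ x : ℝ → State n, x 0 = x₀ ∧
    S.IsClosedLoopSolution f g π (Set.Ici 0) x ∧
    (∀ t, 0 ≤ t → x t ∈ S.safeSet) ∧
    ∀ (T : ℝ) (z : ℝ → State n), z 0 = x₀ →
      S.IsClosedLoopSolution f g π (Set.Icc 0 T) z → Set.EqOn z x (Set.Icc 0 T)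

end Setup

end SafeGP

end

/-!
The posterior is again Gaussian: multiplying the prior by the Gaussian likelihood tilts the joint
law of `F`, `G` and the data, and the characteristic function of the tilted law shows that `f(x)`
and `g(x)` keep the means `μ_f`, `μ_g` and variances `σ_f²`, `σ_g²`.  A sub-Gaussian tail bound at
the points of a `τ`-net of `X`, a union bound and Lipschitz continuity then bound both errors
uniformly on `X` by `√β σ̃` with posterior probability at least `1 - δ`.

Under these bounds the filter constraint is a half-line `0 ≤ c(x) + d(x) u` with Lipschitz `c`, `d`
and `c > 0` where `d = 0`, so `π` is the (locally Lipschitz) projection of `π_nom` onto it.  The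
constraint implies `⟪∇ψ, ẋ⟫ ≥ 0` on `ψ = 0`, and the gradient condition makes `∇ψ` non-zero there:
near the boundary a point with `ψ < 0` has a boundary point at distance `O(|ψ|)`, whence
`dψ/dt ≥ κ ψ` along trajectories that would leave `C`, which Gronwall's inequality forbids.
-/

noncomputable section

namespace SafeGP

section Conditioning

variable {Ω ι : Type*} [MeasurableSpace Ω] [Fintype ι] {P : Measure Ω} {Z : Ω → ℝ}
  {V : ι → Ω → ℝ} {v : ℝ≥0} {a : ι → ℝ}

/-- The residual of the linear predictor `∑ᵢ aᵢ Vᵢ` of `Z`. -/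
def residual (Z : Ω → ℝ) (V : ι → Ω → ℝ) (a : ι → ℝ) (ω : Ω) : ℝ := Z ω - a ⬝ᵥ (V · ω)

lemma memLp_dotProduct (hV : ∀ i, MemLp (V i) 2 P) (a : ι → ℝ) :
    MemLp (fun ω => a ⬝ᵥ (V · ω)) 2 P :=
  memLp_finsetSum _ fun i _ => (hV i).const_mul (a i)

lemma memLp_residual (hZ : MemLp Z 2 P) (hV : ∀ i, MemLp (V i) 2 P) (a : ι → ℝ) :
    MemLp (residual Z V a) 2 P :=
  hZ.sub (memLp_dotProduct hV a)

lemma hasGaussianLaw_residual (hZV : HasGaussianLaw (fun ω => (Z ω, fun i => V i ω)) P)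
    (a : ι → ℝ) : HasGaussianLaw (residual Z V a) P := by
  let L : ℝ × (ι → ℝ) →L[ℝ] ℝ :=
    ContinuousLinearMap.fst ℝ _ _ -
      ∑ i, a i • (ContinuousLinearMap.proj i ∘L ContinuousLinearMap.snd ℝ ℝ (ι → ℝ))
  convert! hZV.map L using 1
  ext ω
  simp [L, residual, dotProduct]

lemma integral_residual (hZ : Integrable Z P) (hV : ∀ i, Integrable (V i) P) (a : ι → ℝ) :
    ∫ ω, residual Z V a ω ∂P = ∫ ω, Z ω ∂P - a ⬝ᵥ fun i => ∫ ω, V i ω ∂P := by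
  have hVi (i : ι) : Integrable (fun ω => a i * V i ω) P := (hV i).const_mul _
  unfold residual dotProduct
  rw [integral_sub hZ (integrable_finsetSum _ fun i _ => hVi i),
    integral_finsetSum _ fun i _ => hVi i]
  simp_rw [integral_const_mul]

lemma covariance_residual_left [IsFiniteMeasure P] {Y : Ω → ℝ} (hZ : MemLp Z 2 P)
    (hV : ∀ i, MemLp (V i) 2 P) (hY : MemLp Y 2 P) (a : ι → ℝ) :
    cov[residual Z V a, Y; P] = cov[Z, Y; P] - a ⬝ᵥ fun i => cov[V i, Y; P] := by
  unfold residual dotProduct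
  rw [covariance_fun_sub_left hZ (memLp_finsetSum _ fun i _ => (hV i).const_mul (a i)) hY,
    covariance_fun_sum_left (fun i => (hV i).const_mul (a i)) hY]
  simp_rw [covariance_const_mul_left]

lemma variance_residual [IsProbabilityMeasure P] (hZ : MemLp Z 2 P) (hV : ∀ i, MemLp (V i) 2 P)
    (ha : ∀ j, cov[residual Z V a, V j; P] = v * a j) :
    Var[residual Z V a; P] = Var[Z; P] - (a ⬝ᵥ fun i => cov[Z, V i; P]) - v * (a ⬝ᵥ a) := by
  have hR := memLp_residual hZ hV a
  have hVR (i : ι) : cov[V i, residual Z V a; P] = (v • a) i := by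
    rw [covariance_comm, ha]; rfl
  have hVZ (i : ι) : cov[V i, Z; P] = cov[Z, V i; P] := covariance_comm _ _
  rw [← covariance_self hR.aestronglyMeasurable.aemeasurable, covariance_residual_left hZ hV hR,
    covariance_comm Z, covariance_residual_left hZ hV hZ]
  simp_rw [hVR, hVZ, covariance_self hZ.aestronglyMeasurable.aemeasurable]
  rw [dotProduct_smul]
  rfl

-- Moving the frequency `s` by `t a` decouples it from `t`: the cross terms of the two summands
-- cancel by the normal equations `ha`.
lemma variance_residual_shift [IsProbabilityMeasure P] (hZ : MemLp Z 2 P)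
    (hV : ∀ i, MemLp (V i) 2 P) (ha : ∀ j, cov[residual Z V a, V j; P] = v * a j) (t : ℝ)
    (s : ι → ℝ) :
    v * ((s + t • a) ⬝ᵥ (s + t • a)) + Var[residual (t • Z) V (s + t • a); P] =
      v * (s ⬝ᵥ s) + Var[residual 0 V s; P] +
        t ^ 2 * (Var[Z; P] - a ⬝ᵥ fun i => cov[Z, V i; P]) := by
  have hR := memLp_residual hZ hV a
  have h0 : MemLp (0 : Ω → ℝ) 2 P := MemLp.zero
  have hsplit : residual (t • Z) V (s + t • a) = t • residual Z V a + residual 0 V s := by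
    ext ω
    simp only [residual, Pi.add_apply, Pi.smul_apply, Pi.zero_apply, add_dotProduct,
      smul_dotProduct, smul_eq_mul]
    ring
  have hcross : cov[residual Z V a, residual 0 V s; P] = -(v * (s ⬝ᵥ a)) := by
    have hVR (i : ι) : cov[V i, residual Z V a; P] = (v • a) i := by
      rw [covariance_comm, ha]; rfl
    rw [covariance_comm, covariance_residual_left h0 hV hR]
    simp_rw [hVR, covariance_zero_left]
    rw [zero_sub, dotProduct_smul]
    rfl
  rw [hsplit, variance_add (hR.const_smul t) (memLp_residual h0 hV s), variance_smul,
    covariance_smul_left, hcross, variance_residual hZ hV ha]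
  simp only [add_dotProduct, dotProduct_add, smul_dotProduct, dotProduct_smul, smul_eq_mul,
    dotProduct_comm a s]
  ring

/-- The weight of the frequency `s` in the Fourier representation of the Gaussian density with
covariance `v I` at the point `w`. -/
def fourierWeight (v : ℝ≥0) (w s : ι → ℝ) : ℂ :=
  Complex.exp ((w ⬝ᵥ s : ℝ) * Complex.I - (v * (s ⬝ᵥ s) / 2 : ℝ))

lemma fourierWeight_eq (v : ℝ≥0) (w s : ι → ℝ) : fourierWeight v w s =
    Complex.exp (-∑ i, (v / 2 : ℂ) * (s i : ℂ) ^ 2 + ∑ i, Complex.I * w i * s i) := by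
  rw [fourierWeight, ← Finset.mul_sum]
  simp_rw [mul_assoc, ← Finset.mul_sum, dotProduct, ← pow_two]
  push_cast
  ring_nf

lemma fourierWeight_sub_left (v : ℝ≥0) (w m s : ι → ℝ) :
    fourierWeight v (w - m) s =
      fourierWeight v w s * Complex.exp ((-(s ⬝ᵥ m) : ℝ) * Complex.I) := by
  rw [fourierWeight, fourierWeight, ← Complex.exp_add, sub_dotProduct, dotProduct_comm m]
  push_cast
  ring_nf

lemma integrable_fourierWeight (hv : v ≠ 0) (w : ι → ℝ) : Integrable (fourierWeight v w) := by
  simp_rw [funext (fourierWeight_eq v w)]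
  exact GaussianFourier.integrable_cexp_neg_sum_mul_add (fun _ => by simpa using hv.bot_lt) _

lemma gaussianPDFReal_eq_cpow_mul_cexp (hv : v ≠ 0) (m y : ℝ) : (gaussianPDFReal m v y : ℂ) =
    (2 * Real.pi : ℂ)⁻¹ * ((Real.pi / (v / 2)) ^ (1 / 2 : ℂ) *
      Complex.exp ((Complex.I * (y - m : ℝ)) ^ 2 / (4 * (v / 2)))) := by
  have : (0 : ℝ) < v := hv.bot_lt
  have hcpow : (Real.pi / (v / 2) : ℂ) ^ (1 / 2 : ℂ) = (√(Real.pi / (v / 2)) : ℝ) := by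
    rw [Real.sqrt_eq_rpow, Complex.ofReal_cpow (by positivity)]
    push_cast
    rfl
  have hsqrt : (2 * Real.pi)⁻¹ * √(Real.pi / (v / 2)) = (√(2 * Real.pi * v))⁻¹ := by
    rw [show Real.pi / (v / 2) = (2 * Real.pi) ^ 2 / (2 * Real.pi * v) by field_simp,
      Real.sqrt_div (by positivity), Real.sqrt_sq (by positivity)]
    field_simp
  rw [hcpow, gaussianPDFReal, ← hsqrt, mul_pow, Complex.I_sq]
  push_cast
  ring_nf

lemma prod_gaussianPDFReal_eq_integral (hv : v ≠ 0) (m y : ι → ℝ) :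
    ((∏ i, gaussianPDFReal (m i) v (y i) : ℝ) : ℂ) =
      (∏ _i : ι, (2 * Real.pi : ℂ)⁻¹) * ∫ s : ι → ℝ, fourierWeight v (y - m) s := by
  simp_rw [fourierWeight_eq, Pi.sub_apply]
  rw [GaussianFourier.integral_cexp_neg_sum_mul_add (fun _ => by simpa using hv.bot_lt),
    ← Finset.prod_mul_distrib, Complex.ofReal_prod]
  exact Finset.prod_congr rfl fun i _ => gaussianPDFReal_eq_cpow_mul_cexp hv _ _

lemma integral_cexp_mul_I_of_hasGaussianLaw {X : Ω → ℝ} (hX : HasGaussianLaw X P)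
    (hX₀ : ∫ ω, X ω ∂P = 0) :
    ∫ ω, Complex.exp (X ω * Complex.I) ∂P = Complex.exp (-(Var[X; P] / 2 : ℝ)) := by
  have h : charFun (P.map X) 1 = ∫ ω, Complex.exp (X ω * Complex.I) ∂P := by
    rw [charFun_apply_real, integral_map hX.aemeasurable (by fun_prop)]
    simp
  rw [← h, hX.map_eq_gaussianReal, charFun_gaussianReal, hX₀,
    Real.coe_toNNReal _ (variance_nonneg _ _)]
  push_cast
  ring_nf

lemma integrable_fourierWeight_mul_cexp_residual [IsFiniteMeasure P] (hZ : AEMeasurable Z P)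
    (hV : ∀ i, AEMeasurable (V i) P) (hv : v ≠ 0) (y : ι → ℝ) :
    Integrable (fun p : Ω × (ι → ℝ) => fourierWeight v y p.2 *
      Complex.exp (residual Z V p.2 p.1 * Complex.I)) (P.prod volume) := by
  refine ((integrable_fourierWeight hv y).comp_snd P).mul_bdd (c := 1) ?_
    (Eventually.of_forall fun p => by rw [Complex.norm_exp_ofReal_mul_I])
  have (i : ι) : AEMeasurable (fun p : Ω × (ι → ℝ) => V i p.1) (P.prod volume) :=
    (hV i).comp_fst
  have : AEMeasurable (fun p : Ω × (ι → ℝ) => Z p.1) (P.prod volume) := hZ.comp_fst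
  unfold residual dotProduct
  fun_prop

lemma integral_cexp_mul_prod_gaussianPDFReal_eq_integral
    (hZV : HasGaussianLaw (fun ω => (Z ω, fun i => V i ω)) P) (hZ₀ : ∫ ω, Z ω ∂P = 0)
    (hV₀ : ∀ i, ∫ ω, V i ω ∂P = 0) (hv : v ≠ 0) (y : ι → ℝ) :
    ∫ ω, Complex.exp (Z ω * Complex.I) * (∏ i, gaussianPDFReal (V i ω) v (y i) : ℝ) ∂P =
      (∏ _i : ι, (2 * Real.pi : ℂ)⁻¹) * ∫ s : ι → ℝ,
        fourierWeight v y s * Complex.exp (-(Var[residual Z V s; P] / 2 : ℝ)) := by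
  have hP := hZV.isProbabilityMeasure
  have hmean (s : ι → ℝ) : ∫ ω, residual Z V s ω ∂P = 0 := by
    rw [integral_residual hZV.fst.integrable fun i => (hZV.snd.eval i).integrable, hZ₀]
    simp_rw [hV₀]
    simp [dotProduct]
  have hfourier (ω : Ω) :
      Complex.exp (Z ω * Complex.I) * (∏ i, gaussianPDFReal (V i ω) v (y i) : ℝ) =
        (∏ _i : ι, (2 * Real.pi : ℂ)⁻¹) * ∫ s : ι → ℝ,
          fourierWeight v y s * Complex.exp (residual Z V s ω * Complex.I) := by
    rw [prod_gaussianPDFReal_eq_integral hv, mul_left_comm, ← integral_const_mul]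
    congr 2 with s
    rw [show y - (fun i => V i ω) = y - (V · ω) from rfl, fourierWeight_sub_left, mul_left_comm,
      ← Complex.exp_add, residual]
    push_cast
    ring_nf
  simp_rw [hfourier]
  rw [integral_const_mul, integral_integral_swap (integrable_fourierWeight_mul_cexp_residual
    hZV.fst.aemeasurable (fun i => (hZV.snd.eval i).aemeasurable) hv y)]
  simp_rw [integral_const_mul,
    integral_cexp_mul_I_of_hasGaussianLaw (hasGaussianLaw_residual hZV _) (hmean _)]

lemma fourierWeight_add_smul [IsProbabilityMeasure P] (hZ : MemLp Z 2 P)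
    (hV : ∀ i, MemLp (V i) 2 P) (ha : ∀ j, cov[residual Z V a, V j; P] = v * a j)
    (y : ι → ℝ) (t : ℝ) (s : ι → ℝ) :
    fourierWeight v y (s + t • a) *
        Complex.exp (-(Var[residual (t • Z) V (s + t • a); P] / 2 : ℝ)) =
      Complex.exp (t * (a ⬝ᵥ y : ℝ) * Complex.I -
          (Var[Z; P] - a ⬝ᵥ fun i => cov[Z, V i; P] : ℝ) * t ^ 2 / 2) *
        (fourierWeight v y s * Complex.exp (-(Var[residual 0 V s; P] / 2 : ℝ))) := by
  have h := congrArg ((↑) : ℝ → ℂ) (eq_sub_of_add_eq' (variance_residual_shift hZ hV ha t s))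
  simp only [fourierWeight, ← Complex.exp_add]
  congr 1
  push_cast at h ⊢
  rw [h, dotProduct_add, dotProduct_smul, smul_eq_mul, dotProduct_comm y a]
  push_cast
  ring

lemma integral_cexp_mul_prod_gaussianPDFReal
    (hZV : HasGaussianLaw (fun ω => (Z ω, fun i => V i ω)) P) (hZ₀ : ∫ ω, Z ω ∂P = 0)
    (hV₀ : ∀ i, ∫ ω, V i ω ∂P = 0) (hv : v ≠ 0)
    (ha : ∀ j, cov[residual Z V a, V j; P] = v * a j) (y : ι → ℝ) (t : ℝ) :
    ∫ ω, Complex.exp (t * Z ω * Complex.I) * (∏ i, gaussianPDFReal (V i ω) v (y i) : ℝ) ∂P =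
      Complex.exp (t * (a ⬝ᵥ y : ℝ) * Complex.I -
          (Var[Z; P] - a ⬝ᵥ fun i => cov[Z, V i; P] : ℝ) * t ^ 2 / 2) *
        (∫ ω, ∏ i, gaussianPDFReal (V i ω) v (y i) ∂P : ℝ) := by
  have hP := hZV.isProbabilityMeasure
  have hscaled (t : ℝ) : HasGaussianLaw (fun ω => ((t • Z) ω, fun i => V i ω)) P :=
    hZV.map ((t • ContinuousLinearMap.fst ℝ ℝ (ι → ℝ)).prod (ContinuousLinearMap.snd ℝ ℝ _))
  have hfourier (t : ℝ) := integral_cexp_mul_prod_gaussianPDFReal_eq_integral (hscaled t)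
    (by simp [integral_const_mul, hZ₀]) hV₀ hv y
  have hevidence := hfourier 0
  simp only [zero_smul, Pi.zero_apply, Complex.ofReal_zero, zero_mul, Complex.exp_zero, one_mul,
    integral_complex_ofReal] at hevidence
  have hshift := hfourier t
  rw [← integral_add_right_eq_self _ (t • a)] at hshift
  simp_rw [fourierWeight_add_smul hZV.fst.memLp_two (fun i => (hZV.snd.eval i).memLp_two) ha,
    integral_const_mul, mul_left_comm _ (Complex.exp _), ← hevidence] at hshift
  simpa using hshift

lemma map_normalized_withDensity_eq [IsProbabilityMeasure P] (hZ : AEMeasurable Z P) {l : Ω → ℝ}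
    (hl : Integrable l P) (hl₀ : ∀ ω, 0 < l ω) {ν : Measure ℝ} [IsFiniteMeasure ν]
    (h : ∀ t : ℝ, ∫ ω, Complex.exp (t * Z ω * Complex.I) * l ω ∂P =
      charFun ν t * (∫ ω, l ω ∂P : ℝ)) :
    ((∫⁻ ω, ENNReal.ofReal (l ω) ∂P)⁻¹ •
      P.withDensity fun ω => ENNReal.ofReal (l ω)).map Z = ν := by
  have hpos : 0 < ∫ ω, l ω ∂P := by
    have hsupp : Function.support l = Set.univ := Set.eq_univ_of_forall fun ω => (hl₀ ω).ne'
    simp [integral_pos_iff_support_of_nonneg (fun ω => (hl₀ ω).le) hl, hsupp]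
  have hevidence : ∫⁻ ω, ENNReal.ofReal (l ω) ∂P = ENNReal.ofReal (∫ ω, l ω ∂P) :=
    (ofReal_integral_eq_lintegral_ofReal hl (Eventually.of_forall fun ω => (hl₀ ω).le)).symm
  rw [hevidence]
  set m := (ENNReal.ofReal (∫ ω, l ω ∂P))⁻¹ • P.withDensity fun ω => ENNReal.ofReal (l ω) with hm
  have hmP : m ≪ P :=
    Measure.smul_absolutelyContinuous.trans (withDensity_absolutelyContinuous _ _)
  have hfin : IsProbabilityMeasure m := ⟨by
    rw [hm, Measure.smul_apply, withDensity_apply _ MeasurableSet.univ, Measure.restrict_univ,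
      smul_eq_mul, hevidence, ENNReal.inv_mul_cancel (ENNReal.ofReal_pos.2 hpos).ne'
      ENNReal.ofReal_ne_top]⟩
  refine Measure.ext_of_charFun (funext fun t => ?_)
  have hweight (ω : Ω) : (ENNReal.ofReal (l ω)).toReal • Complex.exp (t * Z ω * Complex.I) =
      Complex.exp (t * Z ω * Complex.I) * l ω := by
    rw [ENNReal.toReal_ofReal (hl₀ ω).le, Complex.real_smul, mul_comm]
  rw [charFun_apply_real, integral_map (hZ.mono_ac hmP) (by fun_prop), hm, integral_smul_measure,
    integral_withDensity_eq_integral_toReal_smul₀ (by fun_prop)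
      (Eventually.of_forall fun _ => ENNReal.ofReal_lt_top)]
  simp_rw [hweight]
  rw [h, ENNReal.toReal_inv, ENNReal.toReal_ofReal hpos.le, Complex.real_smul, Complex.ofReal_inv,
    mul_left_comm, inv_mul_cancel₀ (Complex.ofReal_ne_zero.2 hpos.ne'), mul_one]

lemma gaussianPDFReal_le (m : ℝ) (v : ℝ≥0) (y : ℝ) :
    gaussianPDFReal m v y ≤ (√(2 * Real.pi * v))⁻¹ :=
  mul_le_of_le_one_right (by positivity) (Real.exp_le_one_iff.2
    (div_nonpos_of_nonpos_of_nonneg (neg_nonpos.2 (sq_nonneg _)) (by positivity)))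

lemma integrable_prod_gaussianPDFReal [IsFiniteMeasure P] (hV : ∀ i, AEMeasurable (V i) P)
    (v : ℝ≥0) (y : ι → ℝ) : Integrable (fun ω => ∏ i, gaussianPDFReal (V i ω) v (y i)) P := by
  refine Integrable.of_bound (AEMeasurable.aestronglyMeasurable ?_)
    (∏ _i : ι, (√(2 * Real.pi * v))⁻¹) (Eventually.of_forall fun ω => ?_)
  · unfold gaussianPDFReal
    fun_prop
  · rw [Real.norm_of_nonneg (Finset.prod_nonneg fun _ _ => gaussianPDFReal_nonneg _ _ _)]
    exact Finset.prod_le_prod (fun _ _ => gaussianPDFReal_nonneg _ _ _)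
      fun _ _ => gaussianPDFReal_le _ _ _

theorem map_normalized_withDensity_eq_gaussianReal
    (hZV : HasGaussianLaw (fun ω => (Z ω, fun i => V i ω)) P) (hZ₀ : ∫ ω, Z ω ∂P = 0)
    (hV₀ : ∀ i, ∫ ω, V i ω ∂P = 0) (hv : v ≠ 0)
    (ha : ∀ j, cov[residual Z V a, V j; P] = v * a j) (y : ι → ℝ) :
    ((∫⁻ ω, ∏ i, gaussianPDF (V i ω) v (y i) ∂P)⁻¹ •
      P.withDensity fun ω => ∏ i, gaussianPDF (V i ω) v (y i)).map Z =
      gaussianReal (a ⬝ᵥ y) (Var[Z; P] - a ⬝ᵥ fun i => cov[Z, V i; P]).toNNReal := by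
  have hP := hZV.isProbabilityMeasure
  have hV (i : ι) := hZV.snd.eval i
  have hvar : 0 ≤ Var[Z; P] - a ⬝ᵥ fun i => cov[Z, V i; P] := by
    have hR := variance_residual hZV.fst.memLp_two (fun i => (hV i).memLp_two) ha
    have ha₀ : 0 ≤ v * (a ⬝ᵥ a) := mul_nonneg v.2 (Finset.sum_nonneg fun i _ => mul_self_nonneg _)
    linarith [variance_nonneg (residual Z V a) P]
  simp_rw [gaussianPDF, ← ENNReal.ofReal_prod_of_nonneg fun _ _ => gaussianPDFReal_nonneg _ _ _]
  refine map_normalized_withDensity_eq hZV.fst.aemeasurable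
    (integrable_prod_gaussianPDFReal (fun i => (hV i).aemeasurable) v y)
    (fun ω => Finset.prod_pos fun i _ => gaussianPDFReal_pos _ _ _ hv) fun t => ?_
  rw [integral_cexp_mul_prod_gaussianPDFReal hZV hZ₀ hV₀ hv ha, charFun_gaussianReal,
    Real.coe_toNNReal _ hvar]

end Conditioning


section Tail

lemma gaussianReal_shift_le {d : ℝ} {s s₀ : Set ℝ} (hs : MeasurableSet s) (hs₀ : MeasurableSet s₀)
    (h : ∀ y, y + d ∈ s → y ∈ s₀ ∧ 0 ≤ y * d) :
    gaussianReal 0 1 s ≤ ENNReal.ofReal (Real.exp (-d ^ 2 / 2)) * gaussianReal 0 1 s₀ := by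
  rw [gaussianReal_apply _ one_ne_zero, gaussianReal_apply _ one_ne_zero, ← lintegral_indicator hs,
    ← lintegral_indicator hs₀, ← lintegral_const_mul _ ((measurable_gaussianPDF 0 1).indicator hs₀),
    ← lintegral_add_right_eq_self _ d]
  refine lintegral_mono fun y => ?_
  by_cases hy : y + d ∈ s
  · obtain ⟨hy₀, hyd⟩ := h y hy
    simp only [Set.indicator_of_mem hy, Set.indicator_of_mem hy₀, gaussianPDF]
    rw [← ENNReal.ofReal_mul (Real.exp_pos _).le]
    refine ENNReal.ofReal_le_ofReal ?_
    simp only [gaussianPDFReal, NNReal.coe_one, mul_one, sub_zero]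
    rw [mul_left_comm, ← Real.exp_add]
    gcongr
    nlinarith
  · simp [Set.indicator_of_notMem hy]

-- Each half-line beyond `± c` is compared with the half-line beyond `0`, so that the two-sided
-- bound costs no factor `2`.
lemma gaussianReal_zero_one_tail_le {c : ℝ} (hc : 0 ≤ c) :
    gaussianReal 0 1 {z | c < |z|} ≤ ENNReal.ofReal (Real.exp (-c ^ 2 / 2)) := by
  have hset : {z : ℝ | c < |z|} = Set.Ioi c ∪ Set.Iio (-c) := by
    ext z
    simp [lt_abs, lt_neg]
  have hright : gaussianReal 0 1 (Set.Ioi c) ≤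
      ENNReal.ofReal (Real.exp (-c ^ 2 / 2)) * gaussianReal 0 1 (Set.Ioi 0) :=
    gaussianReal_shift_le measurableSet_Ioi measurableSet_Ioi fun y hy => by
      have hy₀ : 0 < y := by simpa using hy
      exact ⟨hy₀, by positivity⟩
  have hleft : gaussianReal 0 1 (Set.Iio (-c)) ≤
      ENNReal.ofReal (Real.exp (-c ^ 2 / 2)) * gaussianReal 0 1 (Set.Iio 0) := by
    rw [← neg_sq c]
    refine gaussianReal_shift_le measurableSet_Iio measurableSet_Iio fun y hy => ?_
    have hy₀ : y < 0 := by simpa using hy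
    exact ⟨hy₀, by nlinarith⟩
  calc gaussianReal 0 1 {z | c < |z|}
      ≤ gaussianReal 0 1 (Set.Ioi c) + gaussianReal 0 1 (Set.Iio (-c)) := by
        rw [hset]; exact measure_union_le _ _
    _ ≤ ENNReal.ofReal (Real.exp (-c ^ 2 / 2)) *
        (gaussianReal 0 1 (Set.Ioi 0) + gaussianReal 0 1 (Set.Iio 0)) := by
        rw [mul_add]; exact add_le_add hright hleft
    _ ≤ ENNReal.ofReal (Real.exp (-c ^ 2 / 2)) := by
        rw [← measure_union Set.Ioi_disjoint_Iio_same measurableSet_Iio]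
        exact mul_le_of_le_one_right' prob_le_one

lemma gaussianReal_eq_map_standard (m : ℝ) (v : ℝ≥0) :
    gaussianReal m v = (gaussianReal 0 1).map (fun z => √v * z + m) := by
  rw [← Function.comp_def (· + m) (√v * ·), ← Measure.map_map (by fun_prop) (by fun_prop),
    gaussianReal_map_const_mul, gaussianReal_map_add_const]
  congr 1
  · simp
  · ext
    simp

lemma gaussianReal_tail_le (m : ℝ) (v : ℝ≥0) {c : ℝ} (hc : 0 ≤ c) :
    gaussianReal m v {z | c * √v < |z - m|} ≤ ENNReal.ofReal (Real.exp (-c ^ 2 / 2)) := by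
  rw [gaussianReal_eq_map_standard, Measure.map_apply (by fun_prop)
    (measurableSet_lt (by fun_prop) (by fun_prop))]
  refine (measure_mono fun z hz => ?_).trans (gaussianReal_zero_one_tail_le hc)
  simp only [Set.mem_preimage, Set.mem_ofPred_eq, add_sub_cancel_right, abs_mul,
    abs_of_nonneg (Real.sqrt_nonneg _)] at hz ⊢
  rw [mul_comm] at hz
  exact lt_of_mul_lt_mul_left hz (Real.sqrt_nonneg _)

end Tail

namespace Setup

variable {n N : ℕ} {S : Setup n N} {Ω : Type*} [MeasurableSpace Ω] {P : Measure Ω}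
    {F G : State n → Ω → ℝ}

section Prior

lemma memLp_of_isCenteredGP {k : State n → State n → ℝ} (hF : IsCenteredGP F k P) (x : State n) :
    MemLp (F x) 2 P :=
  (hF.isGaussianProcess.hasGaussianLaw_eval x).memLp_two

/-- The noiseless outputs as random variables. -/
def output (S : Setup n N) (F G : State n → Ω → ℝ) (i : Fin N) (ω : Ω) : ℝ :=
  F (S.D.x i) ω + G (S.D.x i) ω * S.D.u i

lemma hasGaussianLaw_restrict (hF : IsCenteredGP F S.kf P) (hG : IsCenteredGP G S.kg P)
    (hFG : IndepFun (fun ω x => F x ω) (fun ω x => G x ω) P) (I : Finset (State n)) :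
    HasGaussianLaw (fun ω => (I.restrict (F · ω), I.restrict (G · ω))) P :=
  have hr : Measurable (fun h : State n → ℝ => I.restrict h) := by fun_prop
  (hFG.comp hr hr).hasGaussianLaw (hF.isGaussianProcess.hasGaussianLaw I)
    (hG.isGaussianProcess.hasGaussianLaw I)

lemma hasGaussianLaw_prior (hF : IsCenteredGP F S.kf P) (hG : IsCenteredGP G S.kg P)
    (hFG : IndepFun (fun ω x => F x ω) (fun ω x => G x ω) P) (x : State n) :
    HasGaussianLaw (fun ω => ((F x ω, G x ω), fun i => S.output F G i ω)) P := by
  classical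
  let I : Finset (State n) := insert x (Finset.univ.image S.D.x)
  have hx : x ∈ I := Finset.mem_insert_self _ _
  have hD (i : Fin N) : S.D.x i ∈ I :=
    Finset.mem_insert_of_mem (Finset.mem_image_of_mem _ (Finset.mem_univ _))
  let L : ((I → ℝ) × (I → ℝ)) →ₗ[ℝ] (ℝ × ℝ) × (Fin N → ℝ) :=
    { toFun := fun p => ((p.1 ⟨x, hx⟩, p.2 ⟨x, hx⟩),
        fun i => p.1 ⟨S.D.x i, hD i⟩ + p.2 ⟨S.D.x i, hD i⟩ * S.D.u i)
      map_add' := fun p q => by ext <;> simp; ring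
      map_smul' := fun c p => by ext <;> simp; ring }
  exact (hasGaussianLaw_restrict hF hG hFG I).map (LinearMap.toContinuousLinearMap L)

lemma hasGaussianLaw_prior_f (hF : IsCenteredGP F S.kf P) (hG : IsCenteredGP G S.kg P)
    (hFG : IndepFun (fun ω x => F x ω) (fun ω x => G x ω) P) (x : State n) :
    HasGaussianLaw (fun ω => (F x ω, fun i => S.output F G i ω)) P :=
  (hasGaussianLaw_prior hF hG hFG x).map
    (((ContinuousLinearMap.fst ℝ ℝ ℝ).prodMap (ContinuousLinearMap.id ℝ (Fin N → ℝ))))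

lemma hasGaussianLaw_prior_g (hF : IsCenteredGP F S.kf P) (hG : IsCenteredGP G S.kg P)
    (hFG : IndepFun (fun ω x => F x ω) (fun ω x => G x ω) P) (x : State n) :
    HasGaussianLaw (fun ω => (G x ω, fun i => S.output F G i ω)) P :=
  (hasGaussianLaw_prior hF hG hFG x).map
    (((ContinuousLinearMap.snd ℝ ℝ ℝ).prodMap (ContinuousLinearMap.id ℝ (Fin N → ℝ))))

lemma memLp_output (hF : IsCenteredGP F S.kf P) (hG : IsCenteredGP G S.kg P) (i : Fin N) :
    MemLp (S.output F G i) 2 P :=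
  (memLp_of_isCenteredGP hF _).add ((memLp_of_isCenteredGP hG _).mul_const _)

lemma covariance_prior_eq_zero (hF : IsCenteredGP F S.kf P) (hG : IsCenteredGP G S.kg P)
    (hFG : IndepFun (fun ω x => F x ω) (fun ω x => G x ω) P) (x x' : State n) :
    cov[F x, G x'; P] = 0 :=
  IndepFun.covariance_eq_zero (hFG.comp (measurable_pi_apply x) (measurable_pi_apply x'))
    (memLp_of_isCenteredGP hF _) (memLp_of_isCenteredGP hG _)

lemma posterior_absolutelyContinuous (D : Dataset n N) (σ : ℝ≥0) :
    posterior P F G D σ ≪ P :=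
  Measure.smul_absolutelyContinuous.trans (withDensity_absolutelyContinuous _ _)

variable [IsProbabilityMeasure P]

lemma integral_output (hF : IsCenteredGP F S.kf P) (hG : IsCenteredGP G S.kg P) (i : Fin N) :
    ∫ ω, S.output F G i ω ∂P = 0 := by
  unfold output
  rw [integral_add ((memLp_of_isCenteredGP hF _).integrable one_le_two)
    (((memLp_of_isCenteredGP hG _).integrable one_le_two).mul_const _), integral_mul_const,
    hF.mean_eq_zero, hG.mean_eq_zero, zero_mul, add_zero]

lemma covariance_output_right {Z : Ω → ℝ} (hZ : MemLp Z 2 P) (hF : IsCenteredGP F S.kf P)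
    (hG : IsCenteredGP G S.kg P) (j : Fin N) :
    cov[Z, S.output F G j; P] = cov[Z, F (S.D.x j); P] + cov[Z, G (S.D.x j); P] * S.D.u j := by
  rw [show S.output F G j = F (S.D.x j) + fun ω => G (S.D.x j) ω * S.D.u j from rfl,
    covariance_add_right hZ (memLp_of_isCenteredGP hF _)
      ((memLp_of_isCenteredGP hG _).mul_const _), covariance_mul_const_right]

lemma covariance_f_output (hF : IsCenteredGP F S.kf P) (hG : IsCenteredGP G S.kg P)
    (hFG : IndepFun (fun ω x => F x ω) (fun ω x => G x ω) P) (x : State n) (j : Fin N) :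
    cov[F x, S.output F G j; P] = S.kvecf x j := by
  rw [covariance_output_right (memLp_of_isCenteredGP hF _) hF hG, hF.covariance_eq,
    covariance_prior_eq_zero hF hG hFG, zero_mul, add_zero, kvecf]

lemma covariance_g_output (hF : IsCenteredGP F S.kf P) (hG : IsCenteredGP G S.kg P)
    (hFG : IndepFun (fun ω x => F x ω) (fun ω x => G x ω) P) (x : State n) (j : Fin N) :
    cov[G x, S.output F G j; P] = S.kvecg x j := by
  rw [covariance_output_right (memLp_of_isCenteredGP hG _) hF hG, hG.covariance_eq,
    covariance_comm, covariance_prior_eq_zero hF hG hFG, zero_add, kvecg, Matrix.mulVec_diagonal,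
    mul_comm]

lemma covariance_output_output (hF : IsCenteredGP F S.kf P) (hG : IsCenteredGP G S.kg P)
    (hFG : IndepFun (fun ω x => F x ω) (fun ω x => G x ω) P) (i j : Fin N) :
    cov[S.output F G i, S.output F G j; P] = S.gram i j := by
  rw [covariance_comm, covariance_output_right (memLp_output hF hG _) hF hG,
    covariance_comm _ (F _), covariance_f_output hF hG hFG, covariance_comm _ (G _),
    covariance_g_output hF hG hFG, kvecf, kvecg, Matrix.mulVec_diagonal, gram, Matrix.of_apply]
  ring

lemma posSemidef_gram (hF : IsCenteredGP F S.kf P) (hG : IsCenteredGP G S.kg P)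
    (hFG : IndepFun (fun ω x => F x ω) (fun ω x => G x ω) P) : S.gram.PosSemidef := by
  refine Matrix.PosSemidef.of_dotProduct_mulVec_nonneg ?_ fun c => ?_
  · ext i j
    rw [Matrix.conjTranspose_apply, ← covariance_output_output hF hG hFG,
      ← covariance_output_output hF hG hFG, covariance_comm]
    rfl
  · have hm (i : Fin N) : MemLp (fun ω => c i * S.output F G i ω) 2 P :=
      (memLp_output hF hG i).const_mul _
    have hvar := variance_nonneg (fun ω => ∑ i, c i * S.output F G i ω) P
    rw [← covariance_self (memLp_finsetSum _ fun i _ => hm i).aestronglyMeasurable.aemeasurable,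
      covariance_fun_sum_fun_sum hm hm] at hvar
    simp_rw [covariance_const_mul_left, covariance_const_mul_right,
      covariance_output_output hF hG hFG] at hvar
    simpa only [dotProduct, Matrix.mulVec, Pi.star_apply, star_trivial, Finset.mul_sum,
      mul_comm (c _) (S.gram _ _)] using hvar

lemma invGram_mul (hσ : 0 < S.σon) (hF : IsCenteredGP F S.kf P) (hG : IsCenteredGP G S.kg P)
    (hFG : IndepFun (fun ω x => F x ω) (fun ω x => G x ω) P) :
    S.invGram * (S.gram + ((S.σon : ℝ) ^ 2) • 1) = 1 := by
  have hpos : (S.gram + ((S.σon : ℝ) ^ 2) • (1 : Matrix (Fin N) (Fin N) ℝ)).PosDef :=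
    Matrix.PosDef.posSemidef_add (posSemidef_gram hF hG hFG)
      (Matrix.PosDef.one.smul (by positivity))
  exact Matrix.nonsing_inv_mul _ ((Matrix.isUnit_iff_isUnit_det _).1 hpos.isUnit)

lemma covariance_residual_output (hσ : 0 < S.σon) (hF : IsCenteredGP F S.kf P)
    (hG : IsCenteredGP G S.kg P) (hFG : IndepFun (fun ω x => F x ω) (fun ω x => G x ω) P)
    {Z : Ω → ℝ} (hZ : MemLp Z 2 P) {k : Fin N → ℝ} (hk : ∀ j, cov[Z, S.output F G j; P] = k j)
    (j : Fin N) :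
    cov[residual Z (S.output F G) (Matrix.vecMul k S.invGram), S.output F G j; P] =
      (S.σon ^ 2 : ℝ≥0) * Matrix.vecMul k S.invGram j := by
  have hnormal : k j = Matrix.vecMul (Matrix.vecMul k S.invGram) S.gram j +
      S.σon ^ 2 * Matrix.vecMul k S.invGram j := by
    have h := congrFun (congrArg (Matrix.vecMul k) (invGram_mul hσ hF hG hFG)) j
    rw [← Matrix.vecMul_vecMul, Matrix.vecMul_one, Matrix.vecMul_add, Matrix.vecMul_smul,
      Matrix.vecMul_one] at h
    exact h.symm
  rw [covariance_residual_left hZ (memLp_output hF hG) (memLp_output hF hG j), hk, hnormal]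
  simp_rw [covariance_output_output hF hG hFG]
  exact add_sub_cancel_left _ _

lemma map_posterior (hσ : 0 < S.σon) (hF : IsCenteredGP F S.kf P) (hG : IsCenteredGP G S.kg P)
    (hFG : IndepFun (fun ω x => F x ω) (fun ω x => G x ω) P) {Z : Ω → ℝ}
    (hZ : HasGaussianLaw (fun ω => (Z ω, fun i => S.output F G i ω)) P) (hZ₀ : ∫ ω, Z ω ∂P = 0)
    {k : Fin N → ℝ} (hk : ∀ j, cov[Z, S.output F G j; P] = k j) :
    (posterior P F G S.D S.σon).map Z = gaussianReal (k ⬝ᵥ Matrix.mulVec S.invGram S.D.y)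
      (Var[Z; P] - k ⬝ᵥ Matrix.mulVec S.invGram k).toNNReal := by
  have h := map_normalized_withDensity_eq_gaussianReal hZ hZ₀ (integral_output hF hG)
    (pow_ne_zero 2 hσ.ne')
    (covariance_residual_output hσ hF hG hFG hZ.fst.memLp_two hk) S.D.y
  simp_rw [hk] at h
  rw [Matrix.dotProduct_mulVec, Matrix.dotProduct_mulVec]
  exact h

lemma posterior_tail (hσ : 0 < S.σon) (hF : IsCenteredGP F S.kf P) (hG : IsCenteredGP G S.kg P)
    (hFG : IndepFun (fun ω x => F x ω) (fun ω x => G x ω) P) {Z : Ω → ℝ}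
    (hZ : HasGaussianLaw (fun ω => (Z ω, fun i => S.output F G i ω)) P) (hZ₀ : ∫ ω, Z ω ∂P = 0)
    {k : Fin N → ℝ} (hk : ∀ j, cov[Z, S.output F G j; P] = k j) {c : ℝ} (hc : 0 ≤ c) :
    posterior P F G S.D S.σon {ω | c * √(cov[Z, Z; P] - k ⬝ᵥ Matrix.mulVec S.invGram k) <
        |Z ω - k ⬝ᵥ Matrix.mulVec S.invGram S.D.y|} ≤ ENNReal.ofReal (Real.exp (-c ^ 2 / 2)) := by
  have hZm : AEMeasurable Z P := hZ.fst.aemeasurable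
  have ht := gaussianReal_tail_le (k ⬝ᵥ Matrix.mulVec S.invGram S.D.y)
    (Var[Z; P] - k ⬝ᵥ Matrix.mulVec S.invGram k).toNNReal hc
  have hsqrt (r : ℝ) : √(r.toNNReal : ℝ) = √r := by
    rw [Real.sqrt, Real.toNNReal_coe, Real.sqrt]
  rwa [← map_posterior hσ hF hG hFG hZ hZ₀ hk, Measure.map_apply_of_aemeasurable
    (hZm.mono_ac (posterior_absolutelyContinuous _ _))
    (measurableSet_lt (by fun_prop) (by fun_prop)), ← covariance_self hZm, hsqrt] at ht

lemma posterior_tail_f (hσ : 0 < S.σon) (hF : IsCenteredGP F S.kf P) (hG : IsCenteredGP G S.kg P)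
    (hFG : IndepFun (fun ω x => F x ω) (fun ω x => G x ω) P) (x : State n) {c : ℝ} (hc : 0 ≤ c) :
    posterior P F G S.D S.σon {ω | c * S.σf x < |F x ω - S.μf x|} ≤
      ENNReal.ofReal (Real.exp (-c ^ 2 / 2)) := by
  simpa only [hF.covariance_eq x x] using! posterior_tail hσ hF hG hFG
    (hasGaussianLaw_prior_f hF hG hFG x) (hF.mean_eq_zero x) (covariance_f_output hF hG hFG x) hc

lemma posterior_tail_g (hσ : 0 < S.σon) (hF : IsCenteredGP F S.kf P) (hG : IsCenteredGP G S.kg P)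
    (hFG : IndepFun (fun ω x => F x ω) (fun ω x => G x ω) P) (x : State n) {c : ℝ} (hc : 0 ≤ c) :
    posterior P F G S.D S.σon {ω | c * S.σg x < |G x ω - S.μg x|} ≤
      ENNReal.ofReal (Real.exp (-c ^ 2 / 2)) := by
  simpa only [hG.covariance_eq x x] using! posterior_tail hσ hF hG hFG
    (hasGaussianLaw_prior_g hF hG hFG x) (hG.mean_eq_zero x) (covariance_g_output hF hG hFG x) hc

lemma isProbabilityMeasure_posterior (hσ : 0 < S.σon) (hF : IsCenteredGP F S.kf P)
    (hG : IsCenteredGP G S.kg P) (hFG : IndepFun (fun ω x => F x ω) (fun ω x => G x ω) P) :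
    IsProbabilityMeasure (posterior P F G S.D S.σon) := by
  have h := map_posterior hσ hF hG hFG (hasGaussianLaw_prior_f hF hG hFG 0) (hF.mean_eq_zero 0)
    (covariance_f_output hF hG hFG 0)
  have hm : AEMeasurable (F 0) (posterior P F G S.D S.σon) :=
    (hF.isGaussianProcess.aemeasurable 0).mono_ac (posterior_absolutelyContinuous _ _)
  exact (Measure.isProbabilityMeasure_map_iff hm).1 (h ▸ inferInstance)

end Prior

end Setup

section Covering

lemma isCompact_convexHull {E : Type*} [NormedAddCommGroup E] [NormedSpace ℝ E]
    [FiniteDimensional ℝ E] {s : Set E} (hs : IsCompact s) : IsCompact (convexHull ℝ s) := by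
  let hullOf (k : ℕ) : Set E := (fun p : (Fin k → ℝ) × (Fin k → E) => ∑ i, p.1 i • p.2 i) ''
    (stdSimplex ℝ (Fin k) ×ˢ Set.univ.pi fun _ => s)
  have hcompact (k : ℕ) : IsCompact (hullOf k) :=
    ((isCompact_stdSimplex ℝ (Fin k)).prod (isCompact_univ_pi fun _ => hs)).image (by fun_prop)
  have hunion : convexHull ℝ s = ⋃ k ∈ Set.Iic (Module.finrank ℝ E + 1), hullOf k := by
    refine Set.Subset.antisymm (fun x hx => ?_) (Set.iUnion₂_subset fun k _ => ?_)
    · obtain ⟨ι, _, z, w, hz, hindep, hw, hw1, rfl⟩ := eq_pos_convex_span_of_mem_convexHull hx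
      have hcard : Fintype.card ι ≤ Module.finrank ℝ E + 1 :=
        hindep.card_le_finrank_succ.trans (Nat.succ_le_succ (Submodule.finrank_le _))
      let e := (Fintype.equivFin ι).symm
      exact Set.mem_biUnion hcard ⟨(w ∘ e, z ∘ e), ⟨⟨fun i => (hw _).le,
        (Equiv.sum_comp e w).trans hw1⟩, fun i _ => hz ⟨_, rfl⟩⟩,
        Equiv.sum_comp e fun i => w i • z i⟩
    · rintro _ ⟨⟨w, z⟩, ⟨⟨hw, hw1⟩, hz⟩, rfl⟩
      exact mem_convexHull_of_exists_fintype w z hw hw1 (fun i => hz i trivial) rfl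
  rw [hunion]
  exact (Set.finite_Iic _).isCompact_biUnion fun k _ => hcompact k

lemma exists_forall_dist_le_of_convex {E : Type*} [NormedAddCommGroup E] [InnerProductSpace ℝ E]
    {K : Set E} (hK : IsComplete K) (hne : K.Nonempty) (hconv : Convex ℝ K) (c : E) :
    ∃ p ∈ K, ∀ x ∈ K, dist x p ≤ dist x c := by
  obtain ⟨p, hp, hpc⟩ := exists_norm_eq_iInf_of_complete_convex hne hK hconv c
  rw [norm_eq_iInf_iff_real_inner_le_zero hconv hp] at hpc
  refine ⟨p, hp, fun x hx => ?_⟩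
  have hsq := norm_sub_sq_real (x - p) (c - p)
  rw [sub_sub_sub_cancel_right, real_inner_comm] at hsq
  rw [dist_eq_norm, dist_eq_norm]
  refine le_of_sq_le_sq ?_ (norm_nonneg _)
  nlinarith [sq_nonneg ‖c - p‖, hpc x hx]

/-- The centre of the cell with index `k` of the grid with corner `a` and side length `1 / r`. -/
def gridCenter {n : ℕ} (a : Fin n → ℝ) (r : ℝ) (k : Fin n → ℕ) : State n :=
  WithLp.toLp 2 fun j => a j + (k j + 1 / 2) / r

lemma abs_sub_gridCenter_floor_le {n : ℕ} {a : Fin n → ℝ} {r : ℝ} (hr : 0 < r) {x : State n}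
    (hx : ∀ j, a j ≤ x j) (j : Fin n) :
    |x j - gridCenter a r (fun j => ⌊r * (x j - a j)⌋₊) j| ≤ 1 / (2 * r) := by
  have hfloor := Nat.floor_le (mul_nonneg hr.le (sub_nonneg.2 (hx j)))
  have hlt := Nat.lt_floor_add_one (r * (x j - a j))
  have hscale : x j - gridCenter a r (fun j => ⌊r * (x j - a j)⌋₊) j =
      (r * (x j - a j) - ⌊r * (x j - a j)⌋₊ - 1 / 2) / r := by
    simp only [gridCenter]
    field_simp
    ring
  rw [hscale, abs_div, abs_of_pos hr, ← div_div]
  gcongr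
  rw [abs_le]
  constructor <;> linarith

lemma dist_le_sqrt_mul_of_abs_sub_le {n : ℕ} {x y : State n} {ε : ℝ}
    (h : ∀ j, |x j - y j| ≤ ε) : dist x y ≤ √n * ε := by
  rcases n.eq_zero_or_pos with rfl | hn
  · simp [Subsingleton.elim x y]
  have hε : 0 ≤ ε := (abs_nonneg _).trans (h ⟨0, hn⟩)
  rw [EuclideanSpace.dist_eq, ← Real.sqrt_sq hε, ← Real.sqrt_mul n.cast_nonneg]
  refine Real.sqrt_le_sqrt ?_
  calc ∑ j, dist (x j) (y j) ^ 2 ≤ ∑ _j : Fin n, ε ^ 2 := by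
        gcongr with j
        exact h j
    _ = n * ε ^ 2 := by simp

lemma exists_finset_cover_box {n : ℕ} {a w : Fin n → ℝ} (hw : ∀ j, 0 ≤ w j) {τ : ℝ}
    (hτ : 0 < τ) :
    ∃ T : Finset (State n), (T.card : ℝ) ≤ ∏ j, (√n / (2 * τ) * w j + 1) ∧
      ∀ x : State n, (∀ j, a j ≤ x j ∧ x j ≤ a j + w j) → ∃ c ∈ T, dist x c ≤ τ := by
  classical
  set r : ℝ := √n / (2 * τ)
  have hr : 0 ≤ r := by positivity
  set J := Fintype.piFinset fun j => Finset.range (⌊r * w j⌋₊ + 1)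
  refine ⟨J.image (gridCenter a r), ?_, fun x hx => ?_⟩
  · calc ((J.image (gridCenter a r)).card : ℝ) ≤ J.card := by
          exact_mod_cast Finset.card_image_le
      _ = ∏ j, ((⌊r * w j⌋₊ : ℝ) + 1) := by simp [J]
      _ ≤ ∏ j, (r * w j + 1) := by
        gcongr with j
        exact Nat.floor_le (mul_nonneg hr (hw j))
  · refine ⟨gridCenter a r fun j => ⌊r * (x j - a j)⌋₊, Finset.mem_image_of_mem _
      (Fintype.mem_piFinset.2 fun j => ?_), ?_⟩
    · rw [Finset.mem_range, Nat.lt_succ_iff]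
      exact Nat.floor_le_floor (mul_le_mul_of_nonneg_left (by linarith [(hx j).2]) hr)
    · rcases n.eq_zero_or_pos with rfl | hn
      · exact (dist_eq_zero.2 (Subsingleton.elim _ _)).trans_le hτ.le
      have hr_pos : 0 < r := by positivity
      calc dist x (gridCenter a r _) ≤ √n * (1 / (2 * r)) :=
            dist_le_sqrt_mul_of_abs_sub_le (abs_sub_gridCenter_floor_le hr_pos fun j => (hx j).1)
        _ = τ := by
            simp only [r]
            field_simp

/-- An upper bound for the number of grid cells of radius `τ` needed to cover `X`, which is the
product inside the logarithm of `β_f` and `β_g`. For `τ = 0` its value is `1`. -/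
def cellCount {n : ℕ} (X : Set (State n)) (τ : ℝ) : ℝ :=
  ∏ j : Fin n, (√n / (2 * τ) * (sSup ((fun x : State n => x j) '' X) -
    sInf ((fun x : State n => x j) '' X)) + 1)

lemma isCompact_image_coord {n : ℕ} {X : Set (State n)} (hX : IsCompact X) (j : Fin n) :
    IsCompact ((fun x : State n => x j) '' X) :=
  hX.image (by fun_prop)

lemma sInf_coord_le_sSup_coord {n : ℕ} {X : Set (State n)} (hX : IsCompact X) (j : Fin n) :
    sInf ((fun x : State n => x j) '' X) ≤ sSup ((fun x : State n => x j) '' X) :=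
  Real.sInf_le_sSup _ (isCompact_image_coord hX j).bddBelow (isCompact_image_coord hX j).bddAbove

lemma one_le_cellCount {n : ℕ} {X : Set (State n)} (hX : IsCompact X) {τ : ℝ} (hτ : 0 ≤ τ) :
    1 ≤ cellCount X τ :=
  Finset.one_le_prod fun j _ => le_add_of_nonneg_left <|
    mul_nonneg (by positivity) (sub_nonneg.2 (sInf_coord_le_sSup_coord hX j))

lemma exists_finset_cover {n : ℕ} {X : Set (State n)} (hX : IsCompact X) {τ : ℝ} (hτ : 0 < τ) :
    ∃ T : Finset (State n), ↑T ⊆ convexHull ℝ X ∧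
      (T.card : ℝ) ≤ cellCount X τ ∧ ∀ x ∈ X, ∃ p ∈ T, dist x p ≤ τ := by
  classical
  rcases X.eq_empty_or_nonempty with rfl | hne
  · exact ⟨∅, by simp, by simp [cellCount], by simp⟩
  obtain ⟨T, hcard, hT⟩ := exists_finset_cover_box
    (a := fun j => sInf ((fun x : State n => x j) '' X)) (w := fun j =>
      sSup ((fun x : State n => x j) '' X) - sInf ((fun x : State n => x j) '' X))
    (fun j => sub_nonneg.2 (sInf_coord_le_sSup_coord hX j)) hτ
  choose p hpX hp using exists_forall_dist_le_of_convex (isCompact_convexHull hX).isComplete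
    hne.convexHull (convex_convexHull ℝ X)
  refine ⟨T.image p, ?_, le_trans (mod_cast Finset.card_image_le) hcard, fun x hx => ?_⟩
  · intro q hq
    obtain ⟨c, -, rfl⟩ := Finset.mem_image.1 (Finset.mem_coe.1 hq)
    exact hpX c
  · obtain ⟨c, hc, hxc⟩ := hT x fun j =>
      ⟨csInf_le (isCompact_image_coord hX j).bddBelow ⟨x, hx, rfl⟩,
        (le_csSup (isCompact_image_coord hX j).bddAbove ⟨x, hx, rfl⟩).trans_eq
          (add_sub_cancel _ _).symm⟩
    exact ⟨p c, Finset.mem_image_of_mem _ hc, (hp c x (subset_convexHull ℝ X hx)).trans hxc⟩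

lemma exists_finset_mul_dist_le {n : ℕ} {X : Set (State n)} (hX : IsCompact X) {L ε : ℝ}
    (hL : 0 ≤ L) (hε : 0 < ε) :
    ∃ T : Finset (State n), ↑T ⊆ convexHull ℝ X ∧ (T.card : ℝ) ≤ cellCount X (ε / L) ∧
      ∀ x ∈ X, ∃ p ∈ T, L * dist x p ≤ ε := by
  have hone := one_le_cellCount hX (div_nonneg hε.le hL)
  rcases hL.eq_or_lt with rfl | hpos
  · rcases X.eq_empty_or_nonempty with rfl | ⟨x₀, hx₀⟩
    · exact ⟨∅, by simp, by simpa using zero_le_one.trans hone, by simp⟩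
    · exact ⟨{x₀}, by simpa using subset_convexHull ℝ X hx₀, by simpa using hone,
        fun x _ => ⟨x₀, by simp, by simpa using hε.le⟩⟩
  · obtain ⟨T, hTX, hcard, hT⟩ := exists_finset_cover hX (div_pos hε hpos)
    refine ⟨T, hTX, hcard, fun x hx => ?_⟩
    obtain ⟨p, hp, hd⟩ := hT x hx
    exact ⟨p, hp, by rwa [le_div_iff₀ hpos, mul_comm] at hd⟩

-- At the centre `p` the error is at most `√β / 2` standard deviations, which leaves another
-- `√β / 2 ≥ 1` for the variation of `h`, `μ` and `σ` between `p` and `x`.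
lemma abs_sub_le_of_abs_sub_le_center {E : Type*} [PseudoMetricSpace E] {K : Set E}
    {h μ σ : E → ℝ} {Lh Lμ Lσ : ℝ≥0} (hh : LipschitzOnWith Lh h K) (hμ : LipschitzOnWith Lμ μ K)
    (hσ : LipschitzOnWith Lσ σ K) {ε β : ℝ} (hβ : 4 ≤ β) {x p : E} (hx : x ∈ K) (hp : p ∈ K)
    (hd : ((Lh : ℝ) + Lμ + Lσ) * dist x p ≤ ε) (hcenter : |h p - μ p| ≤ √β / 2 * σ p) :
    |h x - μ x| ≤ √β * max (σ x) ε := by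
  have hh_dist : |h x - h p| ≤ Lh * dist x p := hh.dist_le_mul x hx p hp
  have hμ_dist : |μ p - μ x| ≤ Lμ * dist x p := by
    rw [abs_sub_comm]
    exact hμ.dist_le_mul x hx p hp
  have hσ_dist : σ p - σ x ≤ Lσ * dist x p := by
    have h_abs : |σ x - σ p| ≤ Lσ * dist x p := hσ.dist_le_mul x hx p hp
    exact (le_abs_self _).trans (abs_sub_comm (σ x) (σ p) ▸ h_abs)
  have hhalf : 1 ≤ √β / 2 := by
    rw [le_div_iff₀ two_pos]
    exact Real.le_sqrt_of_sq_le (by linarith)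
  calc |h x - μ x| = |(h x - h p) + (h p - μ p) + (μ p - μ x)| := by ring_nf
    _ ≤ |h x - h p| + |h p - μ p| + |μ p - μ x| := abs_add_three _ _ _
    _ ≤ √β / 2 * σ p + (Lh + Lμ) * dist x p := by linarith
    _ ≤ √β / 2 * (σ x + Lσ * dist x p) + √β / 2 * ((Lh + Lμ) * dist x p) := by
      refine add_le_add (by gcongr; linarith) (le_mul_of_one_le_left (by positivity) hhalf)
    _ = √β / 2 * σ x + √β / 2 * (((Lh : ℝ) + Lμ + Lσ) * dist x p) := by ring
    _ ≤ √β / 2 * max (σ x) ε + √β / 2 * max (σ x) ε := by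
      gcongr
      exacts [le_max_left _ _, hd.trans (le_max_right _ _)]
    _ = √β * max (σ x) ε := by ring

lemma four_le_eight_mul_log {a : ℝ} (ha : 2 ≤ a) : 4 ≤ 8 * Real.log a := by
  linarith [Real.log_le_log two_pos ha, Real.log_two_gt_d9]

lemma exp_neg_half_sqrt_eight_mul_log {a : ℝ} (ha : 1 ≤ a) :
    Real.exp (-(√(8 * Real.log a) / 2) ^ 2 / 2) = a⁻¹ := by
  rw [div_pow, Real.sq_sqrt (mul_nonneg (by norm_num) (Real.log_nonneg ha)),
    show -(8 * Real.log a / 2 ^ 2) / 2 = -Real.log a by ring, Real.exp_neg,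
    Real.exp_log (by linarith)]

lemma exists_small_set_uniform_bound {n : ℕ} {Ω : Type*} [MeasurableSpace Ω] {m : Measure Ω}
    {X : Set (State n)} (hX : IsCompact X) {H : State n → Ω → ℝ} {μ σ : State n → ℝ}
    (htail : ∀ p, ∀ c, 0 ≤ c →
      m {ω | c * σ p < |H p ω - μ p|} ≤ ENNReal.ofReal (Real.exp (-c ^ 2 / 2)))
    (Lh : ℝ≥0) {Lμ Lσ : ℝ≥0} (hμ : LipschitzOnWith Lμ μ (convexHull ℝ X))
    (hσ : LipschitzOnWith Lσ σ (convexHull ℝ X)) {δ ε : ℝ} (hδ : δ ∈ Set.Ioo (0 : ℝ) 1)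
    (hε : 0 < ε) :
    ∃ B : Set Ω, m B ≤ ENNReal.ofReal (δ / 2) ∧
      ∀ ω ∉ B, LipschitzOnWith Lh (fun x => H x ω) (convexHull ℝ X) → ∀ x ∈ X, |H x ω - μ x| ≤
        √(8 * Real.log (2 / δ * cellCount X (ε / (Lh + Lμ + Lσ)))) * max (σ x) ε := by
  obtain ⟨T, hTX, hcard, hT⟩ :=
    exists_finset_mul_dist_le hX (L := Lh + Lμ + Lσ) (by positivity) hε
  set M := cellCount X (ε / (Lh + Lμ + Lσ))
  have hM : 1 ≤ M := one_le_cellCount hX (by positivity)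
  have hδ_pos := hδ.1
  have harg : 2 ≤ 2 / δ * M := by
    have : 2 ≤ 2 / δ := by rw [le_div_iff₀ hδ_pos]; linarith [hδ.2]
    nlinarith
  set β := 8 * Real.log (2 / δ * M)
  refine ⟨⋃ p ∈ T, {ω | √β / 2 * σ p < |H p ω - μ p|}, ?_, fun ω hω hlip x hx => ?_⟩
  · calc m (⋃ p ∈ T, {ω | √β / 2 * σ p < |H p ω - μ p|})
        ≤ ∑ p ∈ T, m {ω | √β / 2 * σ p < |H p ω - μ p|} := measure_biUnion_finset_le _ _
      _ ≤ ∑ _p ∈ T, ENNReal.ofReal (2 / δ * M)⁻¹ := by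
        refine Finset.sum_le_sum fun p _ => ?_
        rw [← exp_neg_half_sqrt_eight_mul_log (one_le_two.trans harg)]
        exact htail p _ (by positivity)
      _ = ENNReal.ofReal (T.card * (2 / δ * M)⁻¹) := by
        rw [Finset.sum_const, nsmul_eq_mul, ENNReal.ofReal_mul (by positivity),
          ENNReal.ofReal_natCast]
      _ ≤ ENNReal.ofReal (M * (2 / δ * M)⁻¹) := by gcongr
      _ = ENNReal.ofReal (δ / 2) := by
        congr 1
        field_simp
  · obtain ⟨p, hp, hd⟩ := hT x hx
    simp only [Set.mem_iUnion, not_exists, Set.mem_ofPred_eq, not_lt] at hω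
    exact abs_sub_le_of_abs_sub_le_center hlip hμ hσ (four_le_eight_mul_log harg)
      (subset_convexHull ℝ X hx) (hTX hp) hd (hω p hp)

end Covering

namespace Setup

variable {n N : ℕ} {S : Setup n N} {Ω : Type*} [MeasurableSpace Ω] {P : Measure Ω}
  {F G : State n → Ω → ℝ}

lemma exists_event_uniform_bound [IsProbabilityMeasure P] (hσ : 0 < S.σon)
    (hF : IsCenteredGP F S.kf P) (hG : IsCenteredGP G S.kg P)
    (hFG : IndepFun (fun ω x => F x ω) (fun ω x => G x ω) P)
    (hX : IsCompact S.X) (hδ : S.δ ∈ Set.Ioo (0 : ℝ) 1) (hσlowf : 0 < S.σlowf)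
    (hσlowg : 0 < S.σlowg)
    (hμf : LipschitzOnWith S.Lμf S.μf (convexHull ℝ S.X))
    (hμg : LipschitzOnWith S.Lμg S.μg (convexHull ℝ S.X))
    (hσf : LipschitzOnWith S.Lσf S.σf (convexHull ℝ S.X))
    (hσg : LipschitzOnWith S.Lσg S.σg (convexHull ℝ S.X)) :
    ∃ E : Set Ω, MeasurableSet E ∧ ENNReal.ofReal (1 - S.δ) ≤ posterior P F G S.D S.σon E ∧
      ∀ ω ∈ E, LipschitzOnWith S.Lf (fun x => F x ω) (convexHull ℝ S.X) →
        LipschitzOnWith S.Lg (fun x => G x ω) (convexHull ℝ S.X) → ∀ x ∈ S.X,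
          |F x ω - S.μf x| ≤ √S.βf * S.σtf x ∧ |G x ω - S.μg x| ≤ √S.βg * S.σtg x := by
  have := isProbabilityMeasure_posterior hσ hF hG hFG
  obtain ⟨Bf, hBf, hf⟩ := exists_small_set_uniform_bound hX
    (fun p _ => posterior_tail_f hσ hF hG hFG p) S.Lf hμf hσf hδ hσlowf
  obtain ⟨Bg, hBg, hg⟩ := exists_small_set_uniform_bound hX
    (fun p _ => posterior_tail_g hσ hF hG hFG p) S.Lg hμg hσg hδ hσlowg
  set B := toMeasurable (posterior P F G S.D S.σon) (Bf ∪ Bg)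
  have hB : MeasurableSet B := measurableSet_toMeasurable _ _
  have hsub : Bf ∪ Bg ⊆ B := subset_toMeasurable _ _
  refine ⟨Bᶜ, hB.compl, ?_, fun ω hω hlipf hlipg x hx =>
    ⟨hf ω (fun h => hω (hsub (Or.inl h))) hlipf x hx,
      hg ω (fun h => hω (hsub (Or.inr h))) hlipg x hx⟩⟩
  rw [prob_compl_eq_one_sub hB, measure_toMeasurable, ENNReal.ofReal_sub _ hδ.1.le,
    ENNReal.ofReal_one]
  refine tsub_le_tsub_left ((measure_union_le _ _).trans ((add_le_add hBf hBg).trans_eq ?_)) _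
  rw [← ENNReal.ofReal_add (half_pos hδ.1).le (half_pos hδ.1).le, add_halves]

end Setup

section LipschitzNear

variable {E F G : Type*} [PseudoMetricSpace E] [PseudoMetricSpace F] [PseudoMetricSpace G]

/-- `f` is Lipschitz on a neighbourhood of `x` within `s`: the pointwise form of
`LocallyLipschitzOn`, for maps that are defined by different formulas near different points. -/
def LipschitzNear (s : Set E) (f : E → F) (x : E) : Prop :=
  ∃ K : ℝ≥0, ∃ t ∈ 𝓝[s] x, LipschitzOnWith K f t

namespace LipschitzNear

variable {s : Set E} {x : E}

lemma continuousWithinAt {f : E → F} (hf : LipschitzNear s f x) (hx : x ∈ s) :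
    ContinuousWithinAt f s x := by
  obtain ⟨K, t, ht, hK⟩ := hf
  exact (hK.continuousOn x (mem_of_mem_nhdsWithin hx ht)).mono_of_mem_nhdsWithin ht

lemma congr {f g : E → F} (hf : LipschitzNear s f x) (h : f =ᶠ[𝓝[s] x] g) :
    LipschitzNear s g x := by
  obtain ⟨K, t, ht, hK⟩ := hf
  refine ⟨K, t ∩ {y | f y = g y}, inter_mem ht h, fun y hy z hz => ?_⟩
  rw [← show f y = g y from hy.2, ← show f z = g z from hz.2]
  exact hK hy.1 hz.1

lemma comp {f : E → F} {g : F → G} (hg : LipschitzNear Set.univ g (f x))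
    (hf : LipschitzNear s f x) (hx : x ∈ s) : LipschitzNear s (fun y => g (f y)) x := by
  have hcont := hf.continuousWithinAt hx
  obtain ⟨K, t, ht, hK⟩ := hf
  obtain ⟨K', t', ht', hK'⟩ := hg
  rw [nhdsWithin_univ] at ht'
  exact ⟨K' * K, t ∩ f ⁻¹' t', inter_mem ht (hcont ht'),
    hK'.comp (hK.mono Set.inter_subset_left) fun y hy => hy.2⟩

lemma prodMk {f : E → F} {g : E → G} (hf : LipschitzNear s f x) (hg : LipschitzNear s g x) :
    LipschitzNear s (fun y => (f y, g y)) x := by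
  obtain ⟨K, t, ht, hK⟩ := hf
  obtain ⟨K', t', ht', hK'⟩ := hg
  exact ⟨max K K', t ∩ t', inter_mem ht ht', (hK.mono Set.inter_subset_left).prodMk
    (hK'.mono Set.inter_subset_right)⟩

lemma of_lipschitzOnWith {K : ℝ≥0} {f : E → F} {t : Set E} (h : LipschitzOnWith K f t)
    (hst : s ⊆ t) : LipschitzNear s f x :=
  ⟨K, s, self_mem_nhdsWithin, h.mono hst⟩

lemma of_lipschitzWith {K : ℝ≥0} {f : E → F} (h : LipschitzWith K f) : LipschitzNear s f x :=
  of_lipschitzOnWith h.lipschitzOnWith (Set.subset_univ _)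

lemma of_contDiffAt {E F : Type*} [NormedAddCommGroup E] [NormedSpace ℝ E]
    [NormedAddCommGroup F] [NormedSpace ℝ F] {s : Set E} {x : E} {f : E → F}
    (h : ContDiffAt ℝ 1 f x) : LipschitzNear s f x := by
  obtain ⟨K, t, ht, hK⟩ := h.exists_lipschitzOnWith
  exact ⟨K, t, mem_nhdsWithin_of_mem_nhds ht, hK⟩

lemma const (c : F) : LipschitzNear s (fun _ => c) x := of_lipschitzWith (LipschitzWith.const c)

lemma toEuclideanLin {m n : ℕ} (A : Matrix (Fin m) (Fin n) ℝ) {s : Set (State n)} {x : State n} :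
    LipschitzNear s (fun y => Matrix.toEuclideanLin A y) x :=
  of_lipschitzWith (LinearMap.toContinuousLinearMap (Matrix.toEuclideanLin A)).lipschitz

variable {f g : E → ℝ}

lemma add (hf : LipschitzNear s f x) (hg : LipschitzNear s g x) (hx : x ∈ s) :
    LipschitzNear s (fun y => f y + g y) x :=
  (of_contDiffAt (f := fun p : ℝ × ℝ => p.1 + p.2) (by fun_prop)).comp (hf.prodMk hg) hx

lemma neg (hf : LipschitzNear s f x) (hx : x ∈ s) : LipschitzNear s (fun y => -f y) x :=
  (of_contDiffAt (f := fun p : ℝ => -p) (by fun_prop)).comp hf hx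

lemma sub (hf : LipschitzNear s f x) (hg : LipschitzNear s g x) (hx : x ∈ s) :
    LipschitzNear s (fun y => f y - g y) x :=
  (of_contDiffAt (f := fun p : ℝ × ℝ => p.1 - p.2) (by fun_prop)).comp (hf.prodMk hg) hx

lemma mul (hf : LipschitzNear s f x) (hg : LipschitzNear s g x) (hx : x ∈ s) :
    LipschitzNear s (fun y => f y * g y) x :=
  (of_contDiffAt (f := fun p : ℝ × ℝ => p.1 * p.2) (by fun_prop)).comp (hf.prodMk hg) hx

lemma div (hf : LipschitzNear s f x) (hg : LipschitzNear s g x) (hx : x ∈ s) (h0 : g x ≠ 0) :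
    LipschitzNear s (fun y => f y / g y) x :=
  (of_contDiffAt (f := fun p : ℝ × ℝ => p.1 / p.2)
    (contDiffAt_fst.div contDiffAt_snd h0)).comp (hf.prodMk hg) hx

lemma max (hf : LipschitzNear s f x) (hg : LipschitzNear s g x) (hx : x ∈ s) :
    LipschitzNear s (fun y => max (f y) (g y)) x :=
  (of_lipschitzWith (f := fun p : ℝ × ℝ => Max.max p.1 p.2)
    (LipschitzWith.prod_fst.max LipschitzWith.prod_snd)).comp (hf.prodMk hg) hx

lemma abs (hf : LipschitzNear s f x) (hx : x ∈ s) : LipschitzNear s (fun y => |f y|) x :=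
  (of_lipschitzWith (f := fun p : ℝ => |p|) lipschitzWith_one_norm).comp hf hx

lemma inner {H : Type*} [NormedAddCommGroup H] [InnerProductSpace ℝ H] {f g : E → H}
    (hf : LipschitzNear s f x) (hg : LipschitzNear s g x) (hx : x ∈ s) :
    LipschitzNear s (fun y => (⟪f y, g y⟫ : ℝ)) x :=
  (of_contDiffAt (f := fun p : H × H => (⟪p.1, p.2⟫ : ℝ))
    (contDiff_inner.contDiffAt)).comp (hf.prodMk hg) hx

lemma gradient {H : Type*} [NormedAddCommGroup H] [InnerProductSpace ℝ H]
    [CompleteSpace H] {s : Set H} {ψ : H → ℝ} {x : H} (hψ : ContDiffAt ℝ 2 ψ x) :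
    LipschitzNear s (∇ ψ) x := by
  have hfderiv : ContDiffAt ℝ 1 (fderiv ℝ ψ) x := hψ.fderiv_right (by norm_num)
  exact of_contDiffAt ((InnerProductSpace.toDual ℝ H).symm.contDiff.contDiffAt.comp x hfderiv)

end LipschitzNear

end LipschitzNear

section HalfLine

/-- The point of `{u | 0 ≤ r + d u}` closest to `p`, if this set is nonempty. -/
def halfLineProj (r d p : ℝ) : ℝ := p + max 0 (-(r + d * p)) / d

variable {r d p : ℝ}

lemma halfLineProj_of_nonneg (h : 0 ≤ r + d * p) : halfLineProj r d p = p := by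
  rw [halfLineProj, max_eq_left (by linarith), zero_div, add_zero]

lemma mul_halfLineProj_sub (h : d = 0 → 0 ≤ r) :
    d * (halfLineProj r d p - p) = max 0 (-(r + d * p)) := by
  rw [halfLineProj, add_sub_cancel_left]
  rcases eq_or_ne d 0 with rfl | hd
  · simpa using (h rfl)
  · exact mul_div_cancel₀ _ hd

lemma halfLineProj_eq_iff (h : d = 0 → 0 ≤ r) (u : ℝ) :
    (0 ≤ r + d * u ∧ ∀ v, 0 ≤ r + d * v → |u - p| ≤ |v - p|) ↔ u = halfLineProj r d p := by
  have hmul := mul_halfLineProj_sub (p := p) h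
  have hmem : 0 ≤ r + d * halfLineProj r d p := by
    linarith [le_max_right 0 (-(r + d * p))]
  rcases eq_or_ne d 0 with rfl | hd
  · rw [halfLineProj_of_nonneg (by simpa using h rfl)]
    refine ⟨fun hu => ?_, ?_⟩
    · simpa [sub_eq_zero] using hu.2 p (by simpa using h rfl)
    · rintro rfl
      simpa using h rfl
  have habs : |d| * |halfLineProj r d p - p| = max 0 (-(r + d * p)) := by
    rw [← abs_mul, hmul, abs_of_nonneg (le_max_left _ _)]
  constructor
  · rintro ⟨hu, hmin⟩
    have hle : |d * (u - p)| ≤ max 0 (-(r + d * p)) := by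
      rw [← habs, abs_mul]
      exact mul_le_mul_of_nonneg_left (hmin _ hmem) (abs_nonneg d)
    have heq : d * (u - p) = d * (halfLineProj r d p - p) := by
      rw [hmul]
      rcases max_choice 0 (-(r + d * p)) with hmax | hmax <;> rw [hmax] at hle ⊢
      · exact abs_nonpos_iff.1 hle
      · exact le_antisymm ((le_abs_self _).trans hle) (by linarith)
    linarith [mul_left_cancel₀ hd heq]
  · rintro rfl
    refine ⟨hmem, fun v hv => le_of_mul_le_mul_left ?_ (abs_pos.2 hd)⟩
    rw [habs, ← abs_mul]
    exact max_le (abs_nonneg _) ((by linarith : _ ≤ d * (v - p)).trans (le_abs_self _))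

lemma lipschitzNear_halfLineProj {E : Type*} [PseudoMetricSpace E] {s : Set E} {x : E}
    {r d p : E → ℝ} (hr : LipschitzNear s r x) (hd : LipschitzNear s d x)
    (hp : LipschitzNear s p x) (hx : x ∈ s) (h : d x = 0 → 0 < r x) :
    LipschitzNear s (fun y => halfLineProj (r y) (d y) (p y)) x := by
  have hslack : LipschitzNear s (fun y => r y + d y * p y) x := hr.add (hd.mul hp hx) hx
  rcases eq_or_ne (d x) 0 with hd0 | hd0
  · refine hp.congr ?_
    have hpos : 0 < r x + d x * p x := by simpa [hd0] using h hd0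
    filter_upwards [(hslack.continuousWithinAt hx).eventually (lt_mem_nhds hpos)] with y hy
    exact (halfLineProj_of_nonneg hy.le).symm
  · exact hp.add (((LipschitzNear.const 0).max (hslack.neg hx) hx).div hd hx hd0) hx

end HalfLine

section RobustConstraint

lemma add_mul_nonneg_of_abs_sub_le {r q g m e : ℝ} (hg : |g - m| ≤ e) (hem : e < m)
    (h : 0 ≤ r + q * (m + Real.sign r * e)) : 0 ≤ r + q * g := by
  have hg0 : m - e ≤ g ∧ g ≤ m + e := by constructor <;> linarith [abs_le.1 hg]
  have he : 0 ≤ e := (abs_nonneg _).trans hg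
  rcases le_or_gt 0 q with hq | hq
  · rcases le_or_gt 0 r with hr | hr
    · exact add_nonneg hr (mul_nonneg hq (by linarith))
    · rw [Real.sign_of_neg hr] at h
      have : q * (m - e) ≤ q * g := mul_le_mul_of_nonneg_left hg0.1 hq
      linarith
  · rcases le_or_gt r 0 with hr | hr
    · have : 0 < m + Real.sign r * e := by
        rcases Real.sign_apply_eq r with hs | hs | hs <;> rw [hs] <;> linarith
      linarith [mul_neg_of_neg_of_pos hq this]
    · rw [Real.sign_of_pos hr] at h
      have : q * (m + e) ≤ q * g := mul_le_mul_of_nonpos_left hg0.2 hq.le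
      linarith

lemma sign_neg_mul_mul_mul_abs {m : ℝ} (hm : 0 < m) (d r : ℝ) :
    Real.sign (-d * m * r) * |d| = -d * Real.sign r := by
  rcases lt_trichotomy d 0 with hd | rfl | hd
  · have hdm : 0 < -d * m := mul_pos (neg_pos.2 hd) hm
    rcases lt_trichotomy r 0 with hr | rfl | hr
    · rw [Real.sign_of_neg (mul_neg_of_pos_of_neg hdm hr), Real.sign_of_neg hr, abs_of_neg hd]
      ring
    · simp
    · rw [Real.sign_of_pos (mul_pos hdm hr), Real.sign_of_pos hr, abs_of_neg hd]
      ring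
  · simp
  · have hdm : -d * m < 0 := mul_neg_of_neg_of_pos (neg_neg_of_pos hd) hm
    rcases lt_trichotomy r 0 with hr | rfl | hr
    · rw [Real.sign_of_pos (mul_pos_of_neg_of_neg hdm hr), Real.sign_of_neg hr, abs_of_pos hd]
      ring
    · simp
    · rw [Real.sign_of_neg (mul_neg_of_neg_of_pos hdm hr), Real.sign_of_pos hr, abs_of_pos hd]
      ring

lemma div_add_sign_mul {m e : ℝ} (r : ℝ) :
    r / (m + Real.sign r * e) = max r 0 / (m + e) - max (-r) 0 / (m - e) := by
  rcases lt_trichotomy r 0 with hr | rfl | hr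
  · rw [Real.sign_of_neg hr, max_eq_right hr.le, max_eq_left (by linarith)]
    ring
  · simp
  · rw [Real.sign_of_pos hr, max_eq_left hr.le, max_eq_right (by linarith)]
    ring

end RobustConstraint

namespace Setup

variable {n N : ℕ} (S : Setup n N)

/-- The uniform error bound `√β_g σ̃_g` for the posterior mean of `g`. -/
def errorg (x : State n) : ℝ := √S.βg * S.σtg x

/-- The worst-case input gain: `ξ_s = -⟪∇ψ, b⟫ filterGain`, so that the constraint of the filter
reads `0 ≤ ξ₃ + ⟪∇ψ, b⟫ filterGain u`. -/
def filterGain (x : State n) : ℝ := S.μg x + Real.sign (S.ξ₃ x) * S.errorg x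

/-- The constant term of the constraint of the filter after division by the gain, which then reads
`0 ≤ filterOffset + ⟪∇ψ, b⟫ u`. -/
def filterOffset (x : State n) : ℝ := S.ξ₃ x / S.filterGain x

/-- The control law of the safety filter in closed form. -/
def filterLaw (x : State n) : ℝ :=
  halfLineProj (S.filterOffset x) ⟪∇ S.ψ x, S.b⟫ (S.πnom x)

variable {S} {x : State n}

lemma errorg_nonneg (hσlowg : 0 < S.σlowg) (x : State n) : 0 ≤ S.errorg x :=
  mul_nonneg (Real.sqrt_nonneg _) (hσlowg.le.trans (le_max_right _ _))

lemma abs_errorg_lt_μg (hσlowg : 0 < S.σlowg) (h : 1 < S.μg x / (√S.βg * S.σtg x)) :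
    |S.errorg x| < S.μg x := by
  have hpos : 0 < S.errorg x := by
    refine (errorg_nonneg hσlowg x).lt_of_ne' fun h0 => ?_
    rw [errorg] at h0
    rw [h0, div_zero] at h
    exact h.not_gt one_pos
  rw [abs_of_pos hpos]
  exact (one_lt_div hpos).1 h

lemma filterGain_pos (h : |S.errorg x| < S.μg x) : 0 < S.filterGain x := by
  rw [abs_lt] at h
  rw [filterGain]
  rcases Real.sign_apply_eq (S.ξ₃ x) with hs | hs | hs <;> rw [hs] <;> linarith

lemma ξs_eq (h : |S.errorg x| < S.μg x) : S.ξs x = -⟪∇ S.ψ x, S.b⟫ * S.filterGain x := by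
  have hsign := sign_neg_mul_mul_mul_abs ((abs_nonneg _).trans_lt h) ⟪∇ S.ψ x, S.b⟫ (S.ξ₃ x)
  rw [ξs, ξ₁, ξ₂, filterGain, errorg]
  linear_combination √S.βg * S.σtg x * hsign

lemma mem_feasibleInputs_iff_gain (h : |S.errorg x| < S.μg x) {u : ℝ} :
    u ∈ S.feasibleInputs x ↔ 0 ≤ S.ξ₃ x + ⟪∇ S.ψ x, S.b⟫ * u * S.filterGain x := by
  rw [feasibleInputs, Set.mem_ofPred_eq, ξs_eq h, ← sub_nonneg]
  ring_nf

lemma mem_feasibleInputs_iff (h : |S.errorg x| < S.μg x) {u : ℝ} :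
    u ∈ S.feasibleInputs x ↔ 0 ≤ S.filterOffset x + ⟪∇ S.ψ x, S.b⟫ * u := by
  have hgain := filterGain_pos h
  have hscale : S.ξ₃ x + ⟪∇ S.ψ x, S.b⟫ * u * S.filterGain x =
      (S.filterOffset x + ⟪∇ S.ψ x, S.b⟫ * u) * S.filterGain x := by
    rw [filterOffset, add_mul, div_mul_cancel₀ _ hgain.ne']
  rw [mem_feasibleInputs_iff_gain h, hscale, mul_nonneg_iff_of_pos_right hgain]

lemma filterOffset_pos (h : |S.errorg x| < S.μg x)
    (hgrad : -⟪∇ S.ψ x, Matrix.toEuclideanLin S.A x⟫ < S.α (S.ψ x))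
    (hd : ⟪∇ S.ψ x, S.b⟫ = (0 : ℝ)) : 0 < S.filterOffset x := by
  refine div_pos ?_ (filterGain_pos h)
  simp only [ξ₃, hd, abs_zero, zero_mul]
  linarith

lemma isFilterInput_iff (h : |S.errorg x| < S.μg x)
    (hd : ⟪∇ S.ψ x, S.b⟫ = (0 : ℝ) → 0 < S.filterOffset x) (u : ℝ) :
    S.IsFilterInput x u ↔ u = S.filterLaw x := by
  rw [filterLaw, ← halfLineProj_eq_iff fun h0 => (hd h0).le]
  simp only [IsFilterInput, mem_feasibleInputs_iff h]

section Lipschitz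

variable (hx : x ∈ S.X) (hψ : ContDiffAt ℝ 2 S.ψ x) {Lα : ℝ≥0} (hα : LipschitzWith Lα S.α)
  (hμf : LipschitzNear S.X S.μf x) (hσf : LipschitzNear S.X S.σf x)
  (hμg : LipschitzNear S.X S.μg x) (hσg : LipschitzNear S.X S.σg x)

include hx hψ

lemma lipschitzNear_inner_gradient_b : LipschitzNear S.X (fun y => (⟪∇ S.ψ y, S.b⟫ : ℝ)) x :=
  (LipschitzNear.gradient hψ).inner (LipschitzNear.const _) hx

include hα hμf hσf

lemma lipschitzNear_ξ₃ : LipschitzNear S.X S.ξ₃ x := by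
  have hgrad : LipschitzNear S.X (∇ S.ψ) x := LipschitzNear.gradient hψ
  have hψ' : LipschitzNear S.X S.ψ x := LipschitzNear.of_contDiffAt (hψ.of_le (by norm_num))
  have hd := lipschitzNear_inner_gradient_b hx hψ
  have hnominal := ((LipschitzNear.of_lipschitzWith hα).comp hψ' hx).add
    (hgrad.inner (LipschitzNear.toEuclideanLin S.A) hx) hx
  have herror := ((hd.abs hx).mul (LipschitzNear.const √S.βf) hx).mul
    (hσf.max (LipschitzNear.const S.σlowf) hx) hx
  exact (hnominal.add (hd.mul hμf hx) hx).sub herror hx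

include hμg hσg

lemma lipschitzNear_filterOffset (h : |S.errorg x| < S.μg x) :
    LipschitzNear S.X S.filterOffset x := by
  have hξ := lipschitzNear_ξ₃ hx hψ hα hμf hσf
  have herror : LipschitzNear S.X S.errorg x :=
    (LipschitzNear.const _).mul (hσg.max (LipschitzNear.const S.σlowg) hx) hx
  obtain ⟨hneg, hpos⟩ := abs_lt.1 h
  refine LipschitzNear.congr ?_ (.of_forall fun y => (div_add_sign_mul (S.ξ₃ y)).symm)
  exact ((hξ.max (.const 0) hx).div (hμg.add herror hx) hx (by linarith)).sub
    (((hξ.neg hx).max (.const 0) hx).div (hμg.sub herror hx) hx (by linarith)) hx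

lemma lipschitzNear_filterLaw (hπnom : LipschitzNear S.X S.πnom x)
    (h : |S.errorg x| < S.μg x) (hd : ⟪∇ S.ψ x, S.b⟫ = (0 : ℝ) → 0 < S.filterOffset x) :
    LipschitzNear S.X S.filterLaw x :=
  lipschitzNear_halfLineProj (lipschitzNear_filterOffset hx hψ hα hμf hσf hμg hσg h)
    (lipschitzNear_inner_gradient_b hx hψ) hπnom hx hd

end Lipschitz

lemma nonneg_barrier_condition {f g : State n → ℝ} {u : ℝ} (h : |S.errorg x| < S.μg x)
    (hf : |f x - S.μf x| ≤ √S.βf * S.σtf x) (hg : |g x - S.μg x| ≤ S.errorg x)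
    (hu : u ∈ S.feasibleInputs x) :
    0 ≤ S.α (S.ψ x) + ⟪∇ S.ψ x, dynamics S.A S.b f g x u⟫ := by
  have hrobust : 0 ≤ S.ξ₃ x + ⟪∇ S.ψ x, S.b⟫ * u * g x :=
    add_mul_nonneg_of_abs_sub_le hg ((le_abs_self _).trans_lt h)
      ((mem_feasibleInputs_iff_gain h).1 hu)
  have hferror : ⟪∇ S.ψ x, S.b⟫ * (S.μf x - f x) ≤ |⟪∇ S.ψ x, S.b⟫| * √S.βf * S.σtf x := by
    rw [mul_assoc]
    refine (le_abs_self _).trans ?_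
    rw [abs_mul, abs_sub_comm]
    exact mul_le_mul_of_nonneg_left hf (abs_nonneg _)
  rw [dynamics, inner_add_right, real_inner_smul_right]
  rw [ξ₃] at hrobust
  linarith

end Setup

section GlobalSolution

lemma exists_lipschitzWith_eqOn_abs_le {E : Type*} [PseudoMetricSpace E] {X : Set E} {K R : ℝ≥0}
    {f : E → ℝ} (hf : LipschitzOnWith K f X) (hR : ∀ x ∈ X, |f x| ≤ R) :
    ∃ g : E → ℝ, LipschitzWith K g ∧ (∀ x, |g x| ≤ R) ∧ Set.EqOn f g X := by
  obtain ⟨h, hh, heq⟩ := hf.extend_real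
  have hle : -(R : ℝ) ≤ R := neg_le_self R.2
  refine ⟨fun x => Set.projIcc (-(R : ℝ)) R hle (h x), ?_,
    fun x => abs_le.2 (Set.projIcc _ _ _ _).2, fun x hx => ?_⟩
  · simpa only [one_mul, Function.comp_def] using
      LipschitzWith.subtype_val _ |>.comp ((LipschitzWith.projIcc hle).comp hh)
  · have hmem : h x ∈ Set.Icc (-(R : ℝ)) R := heq hx ▸ abs_le.1 (hR x hx)
    exact (heq hx).trans (congrArg Subtype.val (Set.projIcc_of_mem hle hmem)).symm

lemma exists_lipschitzWith_eqOn_norm_le {E : Type*} [PseudoMetricSpace E] {n : ℕ} {X : Set E}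
    (hX : IsCompact X) {K : ℝ≥0} {v : E → State n} (hv : LipschitzOnWith K v X) :
    ∃ (K' B : ℝ≥0) (w : E → State n), LipschitzWith K' w ∧ (∀ x, ‖w x‖ ≤ B) ∧
      Set.EqOn v w X := by
  obtain ⟨R, hR⟩ := (hX.image_of_continuousOn hv.continuousOn).isBounded.exists_norm_le
  have hcoord (i : Fin n) : LipschitzOnWith K (fun x => v x i) X := by
    simpa using! ((LipschitzWith.eval i).comp (PiLp.lipschitzWith_ofLp 2 _)).comp_lipschitzOnWith hv
  have hcoordR (i : Fin n) (x) (hx : x ∈ X) : |v x i| ≤ R.toNNReal :=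
    ((PiLp.norm_apply_le (v x) i).trans (hR _ (Set.mem_image_of_mem v hx))).trans
      (Real.le_coe_toNNReal R)
  choose g hg hgR hgv using fun i => exists_lipschitzWith_eqOn_abs_le (hcoord i) (hcoordR i)
  have hpi : LipschitzWith K fun x i => g i x := fun x y => edist_pi_le_iff.2 fun i => hg i x y
  have hpiR (x) : ‖fun i => g i x‖ ≤ R.toNNReal :=
    (pi_norm_le_iff_of_nonneg R.toNNReal.2).2 fun i => hgR i x
  obtain ⟨C, htoLp⟩ : ∃ C : ℝ≥0, LipschitzWith C fun y : Fin n → ℝ => WithLp.toLp 2 y :=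
    ⟨_, PiLp.lipschitzWith_toLp 2 fun _ => ℝ⟩
  refine ⟨_, C * R.toNNReal, fun x => WithLp.toLp 2 fun i => g i x, htoLp.comp hpi, fun x => ?_,
    fun x hx => ?_⟩
  · exact (htoLp.norm_le_mul rfl _).trans (mul_le_mul_of_nonneg_left (hpiR x) (NNReal.coe_nonneg _))
  · ext i
    exact hgv i hx

variable {E : Type*} [NormedAddCommGroup E] [NormedSpace ℝ E] {w : E → E} {K : ℝ≥0}

lemma eqOn_of_hasDerivWithinAt (hw : LipschitzWith K w) {T : ℝ} {y z : ℝ → E}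
    (hy : ∀ t ∈ Set.Icc 0 T, HasDerivWithinAt y (w (y t)) (Set.Icc 0 T) t)
    (hz : ∀ t ∈ Set.Icc 0 T, HasDerivWithinAt z (w (z t)) (Set.Icc 0 T) t) (h0 : y 0 = z 0) :
    Set.EqOn y z (Set.Icc 0 T) := by
  have hright {y : ℝ → E} (hy : ∀ t ∈ Set.Icc 0 T, HasDerivWithinAt y (w (y t)) (Set.Icc 0 T) t)
      (t) (ht : t ∈ Set.Ico 0 T) : HasDerivWithinAt y (w (y t)) (Set.Ici t) t :=
    (hy t ⟨ht.1, ht.2.le⟩).mono_of_mem_nhdsWithin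
      (mem_of_superset (Icc_mem_nhdsGE ht.2) (Set.Icc_subset_Icc_left ht.1))
  exact ODE_solution_unique (v := fun _ => w) (fun _ => hw)
    (fun t ht => (hy t ht).continuousWithinAt) (hright hy)
    (fun t ht => (hz t ht).continuousWithinAt) (hright hz) h0

lemma exists_solution_Icc [CompleteSpace E] {B : ℝ≥0} (hw : LipschitzWith K w)
    (hB : ∀ x, ‖w x‖ ≤ B) (x₀ : E) (m : ℕ) :
    ∃ y : ℝ → E, y 0 = x₀ ∧
      ∀ t ∈ Set.Icc (0 : ℝ) m, HasDerivWithinAt y (w (y t)) (Set.Icc (0 : ℝ) m) t := by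
  have hpl : IsPicardLindelof (fun _ => w) (tmin := 0) (tmax := m)
      ⟨0, Set.left_mem_Icc.2 m.cast_nonneg⟩ x₀ (B * m) 0 B K :=
    IsPicardLindelof.of_time_independent (fun x _ => hB x) hw.lipschitzOnWith (by simp)
  exact hpl.exists_eq_forall_mem_Icc_hasDerivWithinAt₀

lemma exists_solution_Ici [CompleteSpace E] {B : ℝ≥0} (hw : LipschitzWith K w)
    (hB : ∀ x, ‖w x‖ ≤ B) (x₀ : E) :
    ∃ x : ℝ → E, x 0 = x₀ ∧
      ∀ t ∈ Set.Ici (0 : ℝ), HasDerivWithinAt x (w (x t)) (Set.Ici 0) t := by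
  choose y hy0 hy using exists_solution_Icc hw hB x₀
  have hcompat {k m : ℕ} (hkm : k ≤ m) : Set.EqOn (y k) (y m) (Set.Icc 0 (k : ℝ)) := by
    have hsub : Set.Icc (0 : ℝ) k ⊆ Set.Icc 0 (m : ℝ) :=
      Set.Icc_subset_Icc_right (by exact_mod_cast hkm)
    exact eqOn_of_hasDerivWithinAt hw (hy k) (fun t ht => (hy m t (hsub ht)).mono hsub)
      ((hy0 k).trans (hy0 m).symm)
  have hglue (m : ℕ) : Set.EqOn (fun t => y ⌈t⌉₊ t) (y m) (Set.Icc 0 (m : ℝ)) := fun t ht =>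
    hcompat (Nat.ceil_le.2 ht.2) ⟨ht.1, Nat.le_ceil t⟩
  refine ⟨fun t => y ⌈t⌉₊ t, hy0 _, fun t ht => ?_⟩
  obtain ⟨m, hm⟩ := exists_nat_gt t
  have hmem : Set.Icc 0 (m : ℝ) ∈ 𝓝[Set.Ici 0] t := by
    rw [← Set.Ici_inter_Iic]
    exact inter_mem self_mem_nhdsWithin (mem_nhdsWithin_of_mem_nhds (Iic_mem_nhds hm))
  have htm : t ∈ Set.Icc 0 (m : ℝ) := ⟨ht, hm.le⟩
  have hderiv := (hy m t htm).mono_of_mem_nhdsWithin hmem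
  rw [← show y ⌈t⌉₊ t = y m t from hglue m htm] at hderiv
  exact hderiv.congr_of_eventuallyEq ((hglue m).eventuallyEq_of_mem hmem) (hglue m htm)

end GlobalSolution

section MetricRegularity

-- Lyusternik–Graves: the surjectivity estimate behind the inverse function theorem is quantitative,
-- so a nearby `y` has a point of the level set of `p` within a multiple of the defect of `f y`.
lemma exists_eq_dist_le_mul_of_hasStrictFDerivAt {E F : Type*} [NormedAddCommGroup E]
    [NormedSpace ℝ E] [CompleteSpace E] [NormedAddCommGroup F] [NormedSpace ℝ F] [CompleteSpace F]
    {f : E → F} {f' : E →L[ℝ] F} {p : E} (hf : HasStrictFDerivAt f f' p) (hf' : f'.range = ⊤) :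
    ∃ C : ℝ, ∀ U ∈ 𝓝 p, ∀ᶠ y in 𝓝 p, ∃ z ∈ U, f z = f p ∧ dist y z ≤ C * dist (f y) (f p) := by
  set N : ℝ≥0 := (f'.nonlinearRightInverseOfSurjective hf').nnnorm with hN
  have hNpos : 0 < N := f'.nonlinearRightInverseOfSurjective_nnnorm_pos hf'
  obtain ⟨s, hs, happrox⟩ := hf.approximates_deriv_on_nhds (c := N⁻¹ / 2) (Or.inr (by positivity))
  refine ⟨2 * N, fun U hU => ?_⟩
  obtain ⟨ρ, hρ, hball⟩ := Metric.mem_nhds_iff.1 (inter_mem hU hs)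
  have hdefect : Tendsto (fun y => dist y p + 2 * N * dist (f y) (f p)) (𝓝 p) (𝓝 0) := by
    have hcont : ContinuousAt (fun y => dist y p + 2 * N * dist (f y) (f p)) p := by
      have := hf.hasFDerivAt.continuousAt
      fun_prop
    simpa [ContinuousAt] using hcont
  filter_upwards [hdefect.eventually (gt_mem_nhds hρ)] with y hy
  have hsub : Metric.closedBall y (2 * N * dist (f y) (f p)) ⊆ U ∩ s := fun z hz =>
    hball ((dist_triangle_right z p y |>.trans (by
      rw [dist_comm p y, add_comm]; exact add_le_add_right hz _)).trans_lt hy)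
  have hsurj := happrox.surjOn_closedBall_of_nonlinearRightInverse
    (f'.nonlinearRightInverseOfSurjective hf') (by positivity) (hsub.trans Set.inter_subset_right)
  obtain ⟨z, hz, hzp⟩ := hsurj (show f p ∈ _ by
    rw [Metric.mem_closedBall, dist_comm, ← hN]
    push_cast
    field_simp
    norm_num)
  exact ⟨z, (hsub hz).1, hzp, by rwa [dist_comm]⟩

end MetricRegularity

section Invariance

lemma nonneg_of_mul_le_deriv {y y' : ℝ → ℝ} {a b κ : ℝ}
    (hy : ContinuousOn y (Set.Icc a b)) (ha : 0 ≤ y a)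
    (hd : ∀ t ∈ Set.Ico a b, HasDerivWithinAt y (y' t) (Set.Ici t) t)
    (hineq : ∀ t ∈ Set.Ico a b, y t < 0 → κ * y t ≤ y' t) :
    ∀ t ∈ Set.Icc a b, 0 ≤ y t := by
  intro t ht
  have hle (ε : ℝ) (hε : 0 < ε) : -y t ≤ ε * Real.exp ((κ + 1) * (t - a)) := by
    have hexp (s : ℝ) : HasDerivAt (fun s => ε * Real.exp ((κ + 1) * (s - a)))
        (ε * (Real.exp ((κ + 1) * (s - a)) * (κ + 1))) s := by
      have hlin : HasDerivAt (fun s => (κ + 1) * (s - a)) (κ + 1) s := by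
        simpa using ((hasDerivAt_id s).sub_const a).const_mul (κ + 1)
      exact hlin.exp.const_mul ε
    refine image_le_of_deriv_right_lt_deriv_boundary (f := fun s => -y s) hy.neg
      (fun s hs => (hd s hs).neg) (by simpa using by linarith) hexp (fun s hs heq => ?_) ht
    have hpos : 0 < ε * Real.exp ((κ + 1) * (s - a)) := by positivity
    linarith [hineq s hs (by linarith), congrArg (κ * ·) heq]
  have hlim : Tendsto (fun ε : ℝ => ε * Real.exp ((κ + 1) * (t - a))) (𝓝[>] 0) (𝓝 0) :=
    (Continuous.tendsto' (by fun_prop) 0 0 (by simp)).mono_left nhdsWithin_le_nhds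
  have hle0 : -y t ≤ 0 := ge_of_tendsto hlim (eventually_mem_nhdsWithin.mono hle)
  linarith

variable {E : Type*} [NormedAddCommGroup E] [NormedSpace ℝ E] {ψ : E → ℝ} {w : E → E} {X : Set E}

lemma eventually_nonneg_comp_of_mul_le_fderiv {x : ℝ → E} {s κ : ℝ}
    (hx : ∀ t ∈ Set.Ici s, HasDerivWithinAt x (w (x t)) (Set.Ici s) t)
    (hψ : ∀ᶠ y in 𝓝 (x s), DifferentiableAt ℝ ψ y)
    (hκ : ∀ᶠ y in 𝓝 (x s), ψ y < 0 → κ * ψ y ≤ fderiv ℝ ψ y (w y)) (h0 : 0 ≤ ψ (x s)) :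
    ∀ᶠ t in 𝓝[>] s, 0 ≤ ψ (x t) := by
  have hxs : ContinuousWithinAt x (Set.Ici s) s := (hx s Set.self_mem_Ici).continuousWithinAt
  obtain ⟨b, hb, hgood⟩ := mem_nhdsGE_iff_exists_Icc_subset.1 (hxs.eventually (hψ.and hκ))
  have hderiv (t) (ht : t ∈ Set.Icc s b) :
      HasDerivWithinAt (fun r => ψ (x r)) (fderiv ℝ ψ (x t) (w (x t))) (Set.Ici s) t :=
    (hgood ht).1.hasFDerivAt.comp_hasDerivWithinAt t (hx t ht.1)
  filter_upwards [Ioo_mem_nhdsGT hb] with t ht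
  exact nonneg_of_mul_le_deriv
    (fun r hr => (hderiv r hr).continuousWithinAt.mono Set.Icc_subset_Ici_self) h0
    (fun r hr => (hderiv r (Set.Ico_subset_Icc_self hr)).mono (Set.Ici_subset_Ici.2 hr.1))
    (fun r hr => (hgood (Set.Ico_subset_Icc_self hr)).2) t (Set.Ioo_subset_Icc_self ht)

variable [CompleteSpace E]

lemma exists_mul_le_of_nonneg_on_zeros {q : E → ℝ} {ψ' : E →L[ℝ] ℝ} {p : E}
    (hψ : HasStrictFDerivAt ψ ψ' p) (hψ' : ψ' ≠ 0) (hp : ψ p = 0)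
    (hq : LipschitzNear Set.univ q p) (hnonneg : ∀ᶠ z in 𝓝 p, ψ z = 0 → 0 ≤ q z) :
    ∃ κ : ℝ, ∀ᶠ y in 𝓝 p, ψ y < 0 → κ * ψ y ≤ q y := by
  obtain ⟨L, t, ht, hL⟩ := hq
  rw [nhdsWithin_univ] at ht
  obtain ⟨C, hC⟩ := exists_eq_dist_le_mul_of_hasStrictFDerivAt hψ
    (Module.Dual.range_eq_top_of_ne_zero (f := (ψ' : E →ₗ[ℝ] ℝ)) (by exact_mod_cast hψ'))
  refine ⟨L * C, ?_⟩
  filter_upwards [hC _ (inter_mem ht hnonneg), ht] with y ⟨z, ⟨hzt, hz⟩, hz0, hyz⟩ hyt hy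
  rw [hp] at hz0
  rw [hp, Real.dist_0_eq_abs, abs_of_neg hy] at hyz
  have hlip : q z - q y ≤ L * (C * -ψ y) :=
    calc q z - q y ≤ dist (q y) (q z) := by rw [dist_comm]; exact le_abs_self _
      _ ≤ L * dist y z := hL.dist_le_mul y hyt z hzt
      _ ≤ L * (C * -ψ y) := mul_le_mul_of_nonneg_left hyz L.2
  linarith [hz hz0]

lemma exists_mul_le_fderiv {K : ℝ≥0} (hw : LipschitzWith K w) {p : E} (hψ : ContDiffAt ℝ 2 ψ p)
    (hne : ψ p = 0 → fderiv ℝ ψ p ≠ 0) (hX : ∀ᶠ y in 𝓝 p, 0 ≤ ψ y → y ∈ X)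
    (hin : ∀ x ∈ X, ψ x = 0 → 0 ≤ fderiv ℝ ψ x (w x)) (hp : 0 ≤ ψ p) :
    ∃ κ : ℝ, ∀ᶠ y in 𝓝 p, ψ y < 0 → κ * ψ y ≤ fderiv ℝ ψ y (w y) := by
  rcases hp.eq_or_lt with hp0 | hpos
  · have hfderiv : LipschitzNear Set.univ (fderiv ℝ ψ) p :=
      .of_contDiffAt (hψ.fderiv_right (by norm_num))
    have happly : LipschitzNear Set.univ (fun y => fderiv ℝ ψ y (w y)) p :=
      LipschitzNear.comp (.of_contDiffAt isBoundedBilinearMap_apply.contDiff.contDiffAt)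
        (hfderiv.prodMk (.of_lipschitzWith hw)) trivial
    refine exists_mul_le_of_nonneg_on_zeros (hψ.hasStrictFDerivAt two_ne_zero) (hne hp0.symm)
      hp0.symm happly ?_
    filter_upwards [hX] with z hz hz0 using hin z (hz hz0.ge) hz0
  · exact ⟨0, (hψ.continuousAt.eventually (lt_mem_nhds hpos)).mono fun y hy hneg =>
      absurd hneg hy.not_gt⟩

-- Nagumo's theorem for a domain with regular boundary, by continuous induction on time.
theorem mem_and_nonneg_of_forall_fderiv_nonneg {K : ℝ≥0} (hw : LipschitzWith K w)
    (hX : IsClosed X) (hψ : ∀ x ∈ X, ContDiffAt ℝ 2 ψ x)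
    (hC : ∀ x ∈ X, 0 ≤ ψ x → ∀ᶠ y in 𝓝 x, 0 ≤ ψ y → y ∈ X)
    (hne : ∀ x ∈ X, ψ x = 0 → fderiv ℝ ψ x ≠ 0)
    (hin : ∀ x ∈ X, ψ x = 0 → 0 ≤ fderiv ℝ ψ x (w x)) {x : ℝ → E}
    (hx : ∀ t ∈ Set.Ici (0 : ℝ), HasDerivWithinAt x (w (x t)) (Set.Ici 0) t)
    (hx0 : x 0 ∈ X ∧ 0 ≤ ψ (x 0)) {t : ℝ} (ht : 0 ≤ t) : x t ∈ X ∧ 0 ≤ ψ (x t) := by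
  have hclosed : IsClosed (X ∩ ψ ⁻¹' Set.Ici 0) :=
    ContinuousOn.preimage_isClosed_of_isClosed
      (fun x hx => (hψ x hx).continuousAt.continuousWithinAt) hX isClosed_Ici
  have hxcont : ContinuousOn x (Set.Icc 0 t) := fun s hs =>
    (hx s hs.1).continuousWithinAt.mono Set.Icc_subset_Ici_self
  suffices Set.Icc 0 t ⊆ x ⁻¹' (X ∩ ψ ⁻¹' Set.Ici 0) from this (Set.right_mem_Icc.2 ht)
  refine IsClosed.Icc_subset_of_forall_mem_nhdsWithin ?_ hx0 ?_
  · rw [Set.inter_comm]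
    exact hxcont.preimage_isClosed_of_isClosed isClosed_Icc hclosed
  · rintro s ⟨⟨hsX, hsψ⟩, hs, -⟩
    have hxs (r) (hr : r ∈ Set.Ici s) : HasDerivWithinAt x (w (x r)) (Set.Ici s) r :=
      (hx r (hs.trans hr)).mono (Set.Ici_subset_Ici.2 hs)
    obtain ⟨κ, hκ⟩ := exists_mul_le_fderiv hw (hψ _ hsX) (hne _ hsX) (hC _ hsX hsψ) hin hsψ
    have hdiff : ∀ᶠ y in 𝓝 (x s), DifferentiableAt ℝ ψ y :=
      ((hψ _ hsX).eventually (by simp)).mono fun y hy => hy.differentiableAt two_ne_zero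
    have hmemX : ∀ᶠ r in 𝓝[>] s, 0 ≤ ψ (x r) → x r ∈ X :=
      ((hxs s Set.self_mem_Ici).continuousWithinAt.eventually (hC _ hsX hsψ)).filter_mono
        (nhdsWithin_mono s Set.Ioi_subset_Ici_self)
    filter_upwards [eventually_nonneg_comp_of_mul_le_fderiv hxs hdiff hκ hsψ, hmemX] with r hr hrX
    exact ⟨hrX hr, hr⟩

end Invariance

namespace Setup

variable {n N : ℕ} {S : Setup n N} {f g : State n → ℝ}

lemma locallyLipschitzOn_filterLaw (hψ : ∀ x ∈ S.X, ContDiffAt ℝ 2 S.ψ x) {Lα : ℝ≥0}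
    (hα : LipschitzWith Lα S.α) (hμf : LipschitzOnWith S.Lμf S.μf (convexHull ℝ S.X))
    (hμg : LipschitzOnWith S.Lμg S.μg (convexHull ℝ S.X))
    (hσf : LipschitzOnWith S.Lσf S.σf (convexHull ℝ S.X))
    (hσg : LipschitzOnWith S.Lσg S.σg (convexHull ℝ S.X)) {Lπ : ℝ≥0}
    (hπnom : LipschitzOnWith Lπ S.πnom S.X) (h : ∀ x ∈ S.X, |S.errorg x| < S.μg x)
    (hd : ∀ x ∈ S.X, ⟪∇ S.ψ x, S.b⟫ = (0 : ℝ) → 0 < S.filterOffset x) :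
    LocallyLipschitzOn S.X S.filterLaw := by
  intro x hx
  have hsub : S.X ⊆ convexHull ℝ S.X := subset_convexHull ℝ S.X
  exact lipschitzNear_filterLaw hx (hψ x hx) hα (.of_lipschitzOnWith hμf hsub)
    (.of_lipschitzOnWith hσf hsub) (.of_lipschitzOnWith hμg hsub) (.of_lipschitzOnWith hσg hsub)
    (.of_lipschitzOnWith hπnom subset_rfl) (h x hx) (hd x hx)

lemma locallyLipschitzOn_dynamics (A : Matrix (Fin n) (Fin n) ℝ) (b : State n)
    {X : Set (State n)} {π : State n → ℝ} (hf : LocallyLipschitzOn X f)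
    (hg : LocallyLipschitzOn X g) (hπ : LocallyLipschitzOn X π) :
    LocallyLipschitzOn X fun x => dynamics A b f g x (π x) := by
  intro x hx
  have hA : LipschitzNear X (fun y => Matrix.toEuclideanLin A y) x := .toEuclideanLin A
  have hinput : LipschitzNear X (fun y => f y + g y * π y) x :=
    LipschitzNear.add (hf hx) (LipschitzNear.mul (hg hx) (hπ hx) hx) hx
  have hsmul : LipschitzNear Set.univ (fun p : State n × ℝ => p.1 + p.2 • b)
      (Matrix.toEuclideanLin A x, f x + g x * π x) :=
    .of_contDiffAt (contDiffAt_fst.add (contDiffAt_snd.smul contDiffAt_const))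
  exact LipschitzNear.comp (f := fun y => (Matrix.toEuclideanLin A y, f y + g y * π y)) hsmul
    (hA.prodMk hinput) hx

lemma isSafe_of_fderiv_dynamics_nonneg {π : State n → ℝ} (hX : IsCompact S.X)
    (hψ : ∀ x ∈ S.X, ContDiffAt ℝ 2 S.ψ x) (hC : ∀ᶠ x in 𝓝ˢ S.safeSet, 0 ≤ S.ψ x → x ∈ S.X)
    (hne : ∀ x ∈ S.X, S.ψ x = 0 → fderiv ℝ S.ψ x ≠ 0)
    (hv : LocallyLipschitzOn S.X fun x => dynamics S.A S.b f g x (π x))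
    (hin : ∀ x ∈ S.X, S.ψ x = 0 → 0 ≤ fderiv ℝ S.ψ x (dynamics S.A S.b f g x (π x))) :
    S.IsSafe f g π := by
  obtain ⟨L, hL⟩ := hv.exists_lipschitzOnWith_of_compact hX
  obtain ⟨K, B, w, hw, hB, heq⟩ := exists_lipschitzWith_eqOn_norm_le hX hL
  replace heq (x) (hx : x ∈ S.X) : dynamics S.A S.b f g x (π x) = w x := heq hx
  have hinw (x) (hx : x ∈ S.X) (h0 : S.ψ x = 0) : 0 ≤ fderiv ℝ S.ψ x (w x) :=
    heq x hx ▸ hin x hx h0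
  have hCx (x) (hx : x ∈ S.X) (h0 : 0 ≤ S.ψ x) : ∀ᶠ y in 𝓝 x, 0 ≤ S.ψ y → y ∈ S.X :=
    hC.filter_mono (nhds_le_nhdsSet (show x ∈ S.safeSet from ⟨hx, h0⟩))
  intro x₀ hx₀
  obtain ⟨x, rfl, hx⟩ := exists_solution_Ici hw hB x₀
  have hsafe (t) (ht : 0 ≤ t) : x t ∈ S.safeSet :=
    mem_and_nonneg_of_forall_fderiv_nonneg hw hX.isClosed hψ hCx hne hinw hx hx₀ ht
  refine ⟨x, rfl, fun t ht => ⟨(hsafe t ht).1, ?_⟩, hsafe, fun T z hz0 hz => ?_⟩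
  · exact heq _ (hsafe t ht).1 ▸ hx t ht
  · exact eqOn_of_hasDerivWithinAt hw (fun t ht => heq _ (hz t ht).1 ▸ (hz t ht).2)
      (fun t ht => (hx t ht.1).mono Set.Icc_subset_Ici_self) hz0

lemma fderiv_ne_zero {x : State n} (hα0 : S.α 0 = 0)
    (hgrad : ⟪∇ S.ψ x, S.b⟫ = (0 : ℝ) →
      -⟪∇ S.ψ x, Matrix.toEuclideanLin S.A x⟫ < S.α (S.ψ x))
    (hx : S.ψ x = 0) : fderiv ℝ S.ψ x ≠ 0 := by
  intro h0
  simp [inner_gradient_left, h0, hx, hα0] at hgrad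

lemma fderiv_dynamics_filterLaw_nonneg {x : State n} (hα0 : S.α 0 = 0)
    (h : |S.errorg x| < S.μg x) (hd : ⟪∇ S.ψ x, S.b⟫ = (0 : ℝ) → 0 < S.filterOffset x)
    (hf : |f x - S.μf x| ≤ √S.βf * S.σtf x) (hg : |g x - S.μg x| ≤ S.errorg x) (hx : S.ψ x = 0) :
    0 ≤ fderiv ℝ S.ψ x (dynamics S.A S.b f g x (S.filterLaw x)) := by
  have hbarrier := nonneg_barrier_condition h hf hg ((isFilterInput_iff h hd _).2 rfl).1
  rwa [hx, hα0, zero_add, inner_gradient_left] at hbarrier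

end Setup

end SafeGP

end

theorem proposition1_general {n N : ℕ} (S : SafeGP.Setup n N)
    {Ω : Type*} [MeasurableSpace Ω] (P : Measure Ω) [IsProbabilityMeasure P]
    (F G : SafeGP.State n → Ω → ℝ)
    (hF : SafeGP.IsCenteredGP F S.kf P) (hG : SafeGP.IsCenteredGP G S.kg P)
    (hFG : IndepFun (fun ω x => F x ω) (fun ω x => G x ω) P) (hσon : 0 < S.σon)
    (hX : IsCompact S.X) (hδ : S.δ ∈ Set.Ioo (0 : ℝ) 1)
    (hσlowf : 0 < S.σlowf) (hσlowg : 0 < S.σlowg)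
    (hμf : LipschitzOnWith S.Lμf S.μf (convexHull ℝ S.X))
    (hμg : LipschitzOnWith S.Lμg S.μg (convexHull ℝ S.X))
    (hσf : LipschitzOnWith S.Lσf S.σf (convexHull ℝ S.X))
    (hσg : LipschitzOnWith S.Lσg S.σg (convexHull ℝ S.X))
    (hπnom : ∃ L : ℝ≥0, LipschitzOnWith L S.πnom S.X)
    (hψ : ∀ x ∈ S.X, ContDiffAt ℝ 2 S.ψ x)
    (hα : ∃ L : ℝ≥0, LipschitzWith L S.α) (hα0 : S.α 0 = 0)
    (hC : ∀ᶠ x in 𝓝ˢ S.safeSet, 0 ≤ S.ψ x → x ∈ S.X)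
    (hgrad : ∀ x ∈ S.X, ⟪∇ S.ψ x, S.b⟫ = (0 : ℝ) →
      -⟪∇ S.ψ x, Matrix.toEuclideanLin S.A x⟫ < S.α (S.ψ x))
    (hexc : ∀ x ∈ S.X, 1 < S.μg x / (√S.βg * S.σtg x)) :
    (∀ x ∈ S.X, (S.feasibleInputs x).Nonempty) ∧
    ∃ π : SafeGP.State n → ℝ,
      (∀ x ∈ S.X, ∀ u, S.IsFilterInput x u ↔ u = π x) ∧
      (∃ L : ℝ≥0, LipschitzOnWith L π S.X) ∧
      ∃ E : Set Ω, MeasurableSet E ∧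
        ENNReal.ofReal (1 - S.δ) ≤ SafeGP.posterior P F G S.D S.σon E ∧
        ∀ ω ∈ E, LipschitzOnWith S.Lf (fun x => F x ω) (convexHull ℝ S.X) →
          LipschitzOnWith S.Lg (fun x => G x ω) (convexHull ℝ S.X) →
          S.IsSafe (fun x => F x ω) (fun x => G x ω) π := by
  obtain ⟨Lα, hα⟩ := hα
  obtain ⟨Lπ, hπnom⟩ := hπnom
  have hμ (x) (hx : x ∈ S.X) : |S.errorg x| < S.μg x :=
    SafeGP.Setup.abs_errorg_lt_μg hσlowg (hexc x hx)
  have hd (x) (hx : x ∈ S.X) (h0 : ⟪∇ S.ψ x, S.b⟫ = (0 : ℝ)) : 0 < S.filterOffset x :=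
    SafeGP.Setup.filterOffset_pos (hμ x hx) (hgrad x hx h0) h0
  have hfilter (x) (hx : x ∈ S.X) := SafeGP.Setup.isFilterInput_iff (hμ x hx) (hd x hx)
  have hπ : LocallyLipschitzOn S.X S.filterLaw :=
    SafeGP.Setup.locallyLipschitzOn_filterLaw hψ hα hμf hμg hσf hσg hπnom hμ hd
  obtain ⟨E, hE, hPE, hbound⟩ := SafeGP.Setup.exists_event_uniform_bound hσon hF hG hFG hX hδ
    hσlowf hσlowg hμf hμg hσf hσg
  refine ⟨fun x hx => ⟨S.filterLaw x, ((hfilter x hx _).2 rfl).1⟩, S.filterLaw, hfilter,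
    hπ.exists_lipschitzOnWith_of_compact hX, E, hE, hPE, fun ω hω hf hg => ?_⟩
  have hsub : S.X ⊆ convexHull ℝ S.X := subset_convexHull ℝ S.X
  exact SafeGP.Setup.isSafe_of_fderiv_dynamics_nonneg hX hψ hC
    (fun x hx => SafeGP.Setup.fderiv_ne_zero hα0 (hgrad x hx))
    (SafeGP.Setup.locallyLipschitzOn_dynamics S.A S.b
      (fun _ _ => SafeGP.LipschitzNear.of_lipschitzOnWith hf hsub)
      (fun _ _ => SafeGP.LipschitzNear.of_lipschitzOnWith hg hsub) hπ)
    (fun x hx => SafeGP.Setup.fderiv_dynamics_filterLaw_nonneg hα0 (hμ x hx) (hd x hx)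
      (hbound ω hω hf hg x hx).1 (hbound ω hω hf hg x hx).2)

theorem proposition1 {n N : ℕ} (S : SafeGP.Setup n N)
    {Ω : Type*} [MeasurableSpace Ω] (P : Measure Ω) [IsProbabilityMeasure P]
    (F G : SafeGP.State n → Ω → ℝ)
    -- independent centred Gaussian process priors for the unknown functions, noisy data
    (hF : SafeGP.IsCenteredGP F S.kf P) (hG : SafeGP.IsCenteredGP G S.kg P)
    (hFG : IndepFun (fun ω x => F x ω) (fun ω x => G x ω) P)
    (hsf : 0 ≤ S.sf) (hkf : ∀ x, S.kf x x = S.sf ^ 2)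
    (hσon : 0 < S.σon)
    -- the domain and the constants
    (hX : IsCompact S.X)
    (hδ : S.δ ∈ Set.Ioo (0 : ℝ) 1) (hσlowf : 0 < S.σlowf) (hσlowg : 0 < S.σlowg)
    (hglow : 0 < S.glow)
    -- Lipschitz constants of the posterior means and standard deviations
    (hμf : LipschitzOnWith S.Lμf S.μf (convexHull ℝ S.X))
    (hμg : LipschitzOnWith S.Lμg S.μg (convexHull ℝ S.X))
    (hσf : LipschitzOnWith S.Lσf S.σf (convexHull ℝ S.X))
    (hσg : LipschitzOnWith S.Lσg S.σg (convexHull ℝ S.X))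
    -- the nominal control law is Lipschitz
    (hπnom : ∃ L : ℝ≥0, LipschitzOnWith L S.πnom S.X)
    -- control barrier function for the nominal system `f = 0`, `g = 1`
    (hψ : ∃ V : Set (SafeGP.State n), IsOpen V ∧ S.X ⊆ V ∧ ContDiffOn ℝ 2 S.ψ V)
    (hα : ∃ L : ℝ≥0, LipschitzWith L S.α)
    (hCBF : SafeGP.IsCBF S.A S.b (fun _ => 0) (fun _ => 1) S.U S.ψ S.α S.safeSet)
    (hC : ∀ᶠ x in 𝓝ˢ S.safeSet, 0 ≤ S.ψ x → x ∈ S.X)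
    -- gradient condition
    (hζ₁ : 0 < S.ζ₁) (hζ₂ : 0 < S.ζ₂)
    (hgrad : ∀ x ∈ S.X, |⟪∇ S.ψ x, S.b⟫| ≤ S.ζ₁ →
      -⟪∇ S.ψ x, Matrix.toEuclideanLin S.A x⟫ + S.ζ₂ ≤ S.α (S.ψ x))
    -- excitation condition
    (hexc : ∀ x ∈ S.X, 1 < S.μg x / (√S.βg * S.σtg x)) :
    -- the filter is feasible
    (∀ x ∈ S.X, (S.feasibleInputs x).Nonempty) ∧
    -- it is a well-defined Lipschitz control law
    ∃ π : SafeGP.State n → ℝ,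
      (∀ x ∈ S.X, ∀ u, S.IsFilterInput x u ↔ u = π x) ∧
      (∃ L : ℝ≥0, LipschitzOnWith L π S.X) ∧
      -- with posterior probability at least `1 - δ` it is safe
      ∃ E : Set Ω, MeasurableSet E ∧
        ENNReal.ofReal (1 - S.δ) ≤ SafeGP.posterior P F G S.D S.σon E ∧
        ∀ ω ∈ E, S.Admissible (fun x => F x ω) (fun x => G x ω) →
          S.IsSafe (fun x => F x ω) (fun x => G x ω) π := by
  obtain ⟨V, hVo, hXV, hψV⟩ := hψ
  have hψ' (x) (hx : x ∈ S.X) : ContDiffAt ℝ 2 S.ψ x := hψV.contDiffAt (hVo.mem_nhds (hXV hx))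
  have hgrad' (x) (hx : x ∈ S.X) (hd : ⟪∇ S.ψ x, S.b⟫ = (0 : ℝ)) :
      -⟪∇ S.ψ x, Matrix.toEuclideanLin S.A x⟫ < S.α (S.ψ x) :=
    (lt_add_of_pos_right _ hζ₂).trans_le (hgrad x hx (by rw [hd, abs_zero]; exact hζ₁.le))
  obtain ⟨hfeas, π, hπ, hL, E, hE, hPE, hsafe⟩ := proposition1_general S P F G hF hG hFG hσon hX hδ
    hσlowf hσlowg hμf hμg hσf hσg hπnom hψ' hα hCBF.1.map_zero hC hgrad' hexc
  exact ⟨hfeas, π, hπ, hL, E, hE, hPE, fun ω hω h => hsafe ω hω h.lipschitz_f h.lipschitz_g⟩
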